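/- \textbf{Definitions.} Let $H$ be a finite undirected graph. An \emph{acyclic moral orientation} (AMO) of $H$ is an orientation of all edges of $H$ that has no directed cycle and no induced subgraph $a\to b\leftarrow c$; $\#\mathrm{AMO}(H)$ is the number of AMOs of $H$. A linear ordering $\tau$ of $V_H$ \emph{represents} an AMO $\alpha$ if $u$ precedes $v$ in $\tau$ for every edge $u\to v$ of $\alpha$. For a clique $K$ of $H$ and a permutation $\pi$ of $K$, let $H^{\pi(K)}$ be the union of all AMOs of $H$ that are represented by some ordering beginning with $\pi$, and let $H^K=\bigcup_\pi H^{\pi(K)}$ (an edge is undirected in a union if both of its directions occur). Let $\mathcal C_H(K)$ be the set of undirected connected components of $H^K[V_H\setminus K]$, i.e. the connected components of the graph formed by its vertices and its undirected edges. For a set $S$ and a collection $R$ of sets, $\phi(S,R)$ is the number of permutations of $S$ no initial segment of which has an element of $R$ as its underlying set. A \emph{rooted clique tree} of $H$ is a triple $\mathcal T=(T,r,\iota)$, where $T$ is a tree with root $r$ and $\iota$ is a bijection from the nodes of $T$ to the maximal cliques of $H$ such that $\{x : v\in\iota(x)\}$ is connected in $T$ for every $v\in V_H$. If $r=x_1,\dots,x_p=v$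 is the path from $r$ to $v$ in $T$, then $\mathrm{FP}(v,\mathcal T)$ is the set of those $\iota(x_i)\cap\iota(x_{i+1})$, $1\le i<p$, that are contained in $\iota(v)$. \textbf{Algorithm (Clique-Picking).} The recursive function $\mathtt{count}(H)$ uses a table $\mathrm{memo}$, which is shared by all calls and initially empty. If $H\in\mathrm{memo}$, return $\mathrm{memo}[H]$. Otherwise take any rooted clique tree $\mathcal T=(T,r,\iota)$ of $H$, set $\mathrm{sum}\leftarrow 0$, and let $Q$ be the queue with the single element $r$. While $Q$ is not empty: pop $v$ from $Q$; push the children of $v$ in $T$ to $Q$; set $\mathrm{prod}\leftarrow 1$; for each $C\in\mathcal C_H(\iota(v))$ set $\mathrm{prod}\leftarrow\mathrm{prod}\cdot\mathtt{count}(C)$; set $\mathrm{sum}\leftarrow\mathrm{sum}+\phi(\iota(v),\mathrm{FP}(v,\mathcal T))\cdot\mathrm{prod}$. Finally set $\mathrm{memo}[H]\leftarrow\mathrm{sum}$ and return $\mathrm{sum}$. \textbf{Theorem.} Let $G$ be a finite undirected connected chordal graph (no set of four or more vertices induces a cycle). Then $\mathtt{count}(G)$, started with the empty table, terminates and returns $\#\mathrm{AMO}(G)$.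 This holds for every choice of the rooted clique trees and of the orders in which children and components are processed; in particular, every rooted clique tree that the algorithm needs exists. -/

import Mathlib

universe u

namespace CliquePicking

/-- A graph is chordal if no set of four or more vertices induces a cycle. -/
def IsChordal {V : Type u} (G : SimpleGraph V) : Prop :=
  ∀ n : ℕ, 4 ≤ n → ¬ (SimpleGraph.cycleGraph n).IsIndContained G

/-! ### Acyclic moral orientations

Partially directed graphs are digraphs: an edge `u - v` is undirected if both `(u, v)` and `(v, u)`
are present, and directed if exactly one of them is. The union of graphs is the supremum. -/

/-- `α` is an orientation of the undirected graph `G`: every edge of `G` is replaced by exactly one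
of its two directions, and there are no other edges. -/
def IsOrientation {V : Type u} (G : SimpleGraph V) (α : Digraph V) : Prop :=
  (∀ u v, G.Adj u v ↔ α.Adj u v ∨ α.Adj v u) ∧ ∀ u v, α.Adj u v → ¬ α.Adj v u

/-- `α` has no directed cycle. -/
def IsAcyclic {V : Type u} (α : Digraph V) : Prop :=
  ∀ v, ¬ Relation.TransGen α.Adj v v

/-- `α` has no v-structure, i.e. no induced subgraph `a → b ← c` with `a ≠ c`. -/
def IsMoral {V : Type u} (α : Digraph V) : Prop :=
  ∀ a b c, a ≠ c → α.Adj a b → α.Adj c b → α.Adj a c ∨ α.Adj c a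

/-- `α` is an acyclic moral orientation (AMO) of `G`. -/
structure IsAMO {V : Type u} (G : SimpleGraph V) (α : Digraph V) : Prop where
  orientation : IsOrientation G α
  acyclic : IsAcyclic α
  moral : IsMoral α

/-- The number of AMOs of `G`. -/
noncomputable def numAMO {V : Type u} (G : SimpleGraph V) : ℕ :=
  {α : Digraph V | IsAMO G α}.ncard

/-! ### Orderings, `G^{π(K)}`, `G^K` and `𝒞_G(K)`

All graphs handled by the algorithm are subgraphs `H` of the input graph `G`; the type `G.Subgraph`
records the vertex set and the edge set of such a graph. -/

/-- The list `l` is a permutation (linear ordering) of the set `S`. -/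
def IsPermOf {V : Type u} (l : List V) (S : Set V) : Prop :=
  l.Nodup ∧ {x | x ∈ l} = S

/-- `τ` is a topological ordering of the vertices of `H` which represents `α`: no edge of `α` goes
from a later to an earlier vertex. -/
def Represents {V : Type u} {G : SimpleGraph V} (H : G.Subgraph) (τ : List V) (α : Digraph V) :
    Prop :=
  IsPermOf τ H.verts ∧ τ.Pairwise fun a b => ¬ α.Adj b a

/-- The `π`-orientation of `H`, where `π` is a permutation of a clique: the union of all AMOs of `H`
which are represented by a topological ordering that begins with `π`. -/
def permOrientation {V : Type u} {G : SimpleGraph V} (H : G.Subgraph) (π : List V) : Digraph V :=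
  sSup {α | IsAMO H.spanningCoe α ∧ ∃ τ, Represents H τ α ∧ π <+: τ}

/-- `H^K`, the union of the `π`-orientations over all permutations `π` of `K`. -/
def cliqueOrientation {V : Type u} {G : SimpleGraph V} (H : G.Subgraph) (K : Set V) : Digraph V :=
  sSup {D | ∃ π, IsPermOf π K ∧ D = permOrientation H π}

theorem cliqueOrientation_adj_sub {V : Type u} {G : SimpleGraph V} (H : G.Subgraph) (K : Set V)
    {a b : V} (h : (cliqueOrientation H K).Adj a b) : H.Adj a b := by
  obtain ⟨_, ⟨π, -, rfl⟩, α, ⟨hα, -⟩, hab⟩ := h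
  exact (hα.orientation.1 a b).2 (Or.inl hab)

/-- The undirected part of the induced subgraph `H^K[V_H ∖ K]`. -/
def undirectedPart {V : Type u} {G : SimpleGraph V} (H : G.Subgraph) (K : Set V) :
    G.Subgraph where
  verts := H.verts \ K
  Adj a b := a ∈ H.verts \ K ∧ b ∈ H.verts \ K ∧
    (cliqueOrientation H K).Adj a b ∧ (cliqueOrientation H K).Adj b a
  adj_sub h := (cliqueOrientation_adj_sub H K h.2.2.1).adj_sub
  edge_vert h := h.1
  symm := ⟨fun _ _ h => ⟨h.2.1, h.1, h.2.2.2, h.2.2.1⟩⟩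

/-- `𝒞_H(K)`: the undirected connected components of `H^K[V_H ∖ K]`, i.e. the maximal connected
subgraphs of its undirected part. -/
def components {V : Type u} {G : SimpleGraph V} (H : G.Subgraph) (K : Set V) : Set G.Subgraph :=
  {C | Maximal (fun C' : G.Subgraph => C' ≤ undirectedPart H K ∧ C'.Connected) C}

/-! ### The function `φ`, clique trees and forbidden prefixes -/

/-- `φ(S, R)`: the number of permutations of `S` that do not have a set in `R` as a prefix. -/
noncomputable def phi {V : Type u} (S : Set V) (R : Set (Set V)) : ℕ :=
  {l : List V | IsPermOf l S ∧ ∀ p, p <+: l → {x | x ∈ p} ∉ R}.ncard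

/-- `Π(H)`: the set of maximal cliques of `H`. -/
def maxCliques {V : Type u} {G : SimpleGraph V} (H : G.Subgraph) : Set (Set V) :=
  {K | Maximal (fun K' : Set V => K' ⊆ H.verts ∧ K'.Pairwise H.Adj) K}

/-- A rooted clique tree `(T, r, ι)` of `H`. -/
structure RootedCliqueTree {V : Type u} {G : SimpleGraph V} (H : G.Subgraph) where
  Node : Type u
  tree : SimpleGraph Node
  isTree : tree.IsTree
  root : Node
  ι : Node → Set V
  bijOn : Set.BijOn ι Set.univ (maxCliques H)
  connected : ∀ v ∈ H.verts, (tree.induce {x | v ∈ ι x}).Connected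

/-- `w` is a child of `v` in the rooted tree. -/
def RootedCliqueTree.IsChild {V : Type u} {G : SimpleGraph V} {H : G.Subgraph}
    (T : RootedCliqueTree H) (v w : T.Node) : Prop :=
  T.tree.Adj v w ∧ T.tree.dist T.root w = T.tree.dist T.root v + 1

/-- `FP(v, T)`: the sets `ι(x) ∩ ι(y) ⊆ ι(v)` for consecutive nodes `x`, `y` on the path from the
root to `v`. -/
def RootedCliqueTree.FP {V : Type u} {G : SimpleGraph V} {H : G.Subgraph}
    (T : RootedCliqueTree H) (v : T.Node) : Set (Set V) :=
  {S | ∃ p : T.tree.Walk T.root v, p.IsPath ∧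
    ∃ d ∈ p.darts, S = T.ι d.fst ∩ T.ι d.snd ∧ S ⊆ T.ι v}

/-! ### The Clique-Picking algorithm

The recursive function `count` is given as a transition system. It is nondeterministic: the rooted
clique tree, the order in which the children of a node are pushed, and the order in which the
components are processed are arbitrary. -/

/-- The list `l` enumerates the set `s`, every element once. -/
def Enumerates {A : Type*} (l : List A) (s : Set A) : Prop :=
  l.Nodup ∧ ∀ a, a ∈ l ↔ a ∈ s

/-- The table of stored results; it is shared by all calls of `count`. -/
abbrev Memo {V : Type u} (G : SimpleGraph V) : Type u := G.Subgraph → Option ℕ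

/-- The local variables of a call of `count` that are alive during the whole `while` loop: the
argument, the clique tree, the variable `sum` and the queue `Q` (its head is popped first). -/
structure Frame {V : Type u} (G : SimpleGraph V) where
  graph : G.Subgraph
  T : RootedCliqueTree graph
  sum : ℕ
  queue : List T.Node

/-- A call of `count` inside the `foreach` loop for the node `node`: additionally the variable
`prod` and the list of components `H` that have not been processed yet. -/
structure LoopFrame {V : Type u} (G : SimpleGraph V) extends Frame G where
  node : T.Node
  prod : ℕ
  todo : List G.Subgraph

/-- The states of the algorithm. The stack holds the suspended calls of `count`, each of which is
waiting for the result of the recursive call in its `foreach` loop. -/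
inductive State {V : Type u} (G : SimpleGraph V)
  /-- `count H` is about to be executed. -/
  | call (H : G.Subgraph) (stack : List (LoopFrame G)) (memo : Memo G)
  /-- The test of the `while` loop. -/
  | whileLoop (f : Frame G) (stack : List (LoopFrame G)) (memo : Memo G)
  /-- The test of the `foreach` loop. -/
  | forLoop (f : LoopFrame G) (stack : List (LoopFrame G)) (memo : Memo G)
  /-- The current call of `count` has returned `n`. -/
  | ret (n : ℕ) (stack : List (LoopFrame G)) (memo : Memo G)

open Classical in
/-- One step of the algorithm. -/
inductive Step {V : Type u} {G : SimpleGraph V} : State G → State G → Prop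
  /-- `if H ∈ memo then return memo[H]` -/
  | lookup {H : G.Subgraph} {stack : List (LoopFrame G)} {memo : Memo G} {n : ℕ}
      (h : memo H = some n) :
      Step (.call H stack memo) (.ret n stack memo)
  /-- Otherwise: `(T, r, ι) ←` a rooted clique tree of `H`; `sum ← 0`; `Q ←` queue with the single
  element `r`. -/
  | start {H : G.Subgraph} {stack : List (LoopFrame G)} {memo : Memo G}
      (h : memo H = none) (T : RootedCliqueTree H) :
      Step (.call H stack memo) (.whileLoop ⟨H, T, 0, [T.root]⟩ stack memo)
  /-- `Q` is not empty: `v ← pop(Q)`; `push(Q, children(v))`; `prod ← 1`; enter the `foreach` loop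
  over `𝒞_H(ι(v))`. -/
  | pop {H : G.Subgraph} {T : RootedCliqueTree H} {sum : ℕ} {v : T.Node} {Q : List T.Node}
      {stack : List (LoopFrame G)} {memo : Memo G}
      {children : List T.Node} (hchildren : Enumerates children {w | T.IsChild v w})
      {comps : List G.Subgraph} (hcomps : Enumerates comps (components H (T.ι v))) :
      Step (.whileLoop ⟨H, T, sum, v :: Q⟩ stack memo)
        (.forLoop ⟨⟨H, T, sum, Q ++ children⟩, v, 1, comps⟩ stack memo)
  /-- The next component `C` of the `foreach` loop: call `count C`. -/
  | recurse {f : Frame G} {v : f.T.Node} {prod : ℕ} {C : G.Subgraph} {todo : List G.Subgraph}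
      {stack : List (LoopFrame G)} {memo : Memo G} :
      Step (.forLoop ⟨f, v, prod, C :: todo⟩ stack memo)
        (.call C (⟨f, v, prod, todo⟩ :: stack) memo)
  /-- The recursive call has returned `n`: `prod ← prod * n`. -/
  | resume {f : Frame G} {v : f.T.Node} {prod : ℕ} {todo : List G.Subgraph} {n : ℕ}
      {stack : List (LoopFrame G)} {memo : Memo G} :
      Step (.ret n (⟨f, v, prod, todo⟩ :: stack) memo)
        (.forLoop ⟨f, v, prod * n, todo⟩ stack memo)
  /-- The `foreach` loop is finished: `sum ← sum + φ(ι(v), FP(v, T)) * prod`. -/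
  | add {H : G.Subgraph} {T : RootedCliqueTree H} {sum : ℕ} {Q : List T.Node} {v : T.Node}
      {prod : ℕ} {stack : List (LoopFrame G)} {memo : Memo G} :
      Step (.forLoop ⟨⟨H, T, sum, Q⟩, v, prod, []⟩ stack memo)
        (.whileLoop ⟨H, T, sum + phi (T.ι v) (T.FP v) * prod, Q⟩ stack memo)
  /-- `Q` is empty: `memo[H] = sum`; return `sum`. -/
  | finish {H : G.Subgraph} {T : RootedCliqueTree H} {sum : ℕ}
      {stack : List (LoopFrame G)} {memo : Memo G} :
      Step (.whileLoop ⟨H, T, sum, []⟩ stack memo)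
        (.ret sum stack (Function.update memo H (some sum)))

/-- The initial state on input `G`: `count G` with an empty table. -/
def State.init {V : Type u} (G : SimpleGraph V) : State G :=
  .call ⊤ [] fun _ => none

/-- The algorithm on input `G` always returns `n`, whatever choices it makes: there is no infinite
run, and a run that cannot be continued has returned `n` from the outermost call of `count`. -/
def Returns {V : Type u} (G : SimpleGraph V) (n : ℕ) : Prop :=
  (¬ ∃ run : ℕ → State G, run 0 = State.init G ∧ ∀ i, Step (run i) (run (i + 1))) ∧
  ∀ s : State G, Relation.ReflTransGen Step (State.init G) s → (∀ s', ¬ Step s s') →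
    ∃ memo, s = .ret n [] memo

end CliquePicking

/-! Call a set initial in an AMO if it is closed under parents. The count rests on assigning to each
AMO `α` of a connected chordal graph `H` exactly one node `v` of the clique tree: the node for which
`ι v` is initial in `α` while no set in `FP v` is (`IsStart`).

Uniqueness (`isStart_unique`): suppose `ι v` and `ι w` are both initial and no separator on the path
from `v` to `w` equals their intersection. After deleting the intersection, the rests of the two
cliques still lie in one component, and each contributes a source. But a moral acyclic orientation
of a connected graph has only one source. So the intersection is a separator on that path, hence
also on the root path of `v` or of `w`; being initial, it is a forbidden prefix there.

Existence (`exists_isStart`): an initial maximal clique is obtained by growing the empty set. If a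
smallest initial forbidden prefix `P` remains, regrow `P` in the part of the tree reached from the
root before any separator equal to `P`. All initial forbidden prefixes of the new clique are larger
than `P`, so the process ends.

For a fixed clique `K` and a fixed order `π` on it, the AMOs in which `K` is initial and ordered by
`π` correspond to families of AMOs of the components in `𝒞_H(K)` (`bijective_restrict_components`).
Edges between different classes have a direction forced by `K`, and a forced edge into one vertex of
a component extends to the whole component (`Forced.of_freeGraph_adj`), so orientations of the
components can be glued without creating cycles or v-structures. Initial subsets of an initial
clique are exactly the prefixes of its ordering, so `φ` counts the admissible orders, and summing
over the nodes gives `numAMO_eq_sum`.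

The components are induced, connected and smaller, so the algorithm is correct by induction on the
number of vertices. Clique trees exist by successive removal of simplicial vertices. -/

namespace CliquePicking

/-! ### Chordal graphs -/

/-- The edges of `G` between vertices of `X`, as a graph on the whole vertex type. -/
def within {V : Type*} (G : SimpleGraph V) (X : Set V) : SimpleGraph V where
  Adj a b := G.Adj a b ∧ a ∈ X ∧ b ∈ X
  symm := ⟨fun _ _ h => ⟨h.1.symm, h.2.2, h.2.1⟩⟩
  loopless := ⟨fun _ h => G.loopless.irrefl _ h.1⟩

theorem within_mono {V : Type*} {G : SimpleGraph V} {X Y : Set V} (h : X ⊆ Y) :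
    within G X ≤ within G Y :=
  fun _ _ hab => ⟨hab.1, h hab.2.1, h hab.2.2⟩

theorem mem_of_reachable_within {V : Type*} {G : SimpleGraph V} {X : Set V} {a b : V} (ha : a ∈ X)
    (h : (within G X).Reachable a b) : b ∈ X := by
  rw [SimpleGraph.reachable_iff_reflTransGen] at h
  induction h with
  | refl => exact ha
  | tail _ hbc _ => exact hbc.2.2

/-- The vertices reachable inside `X` are reachable through reachable vertices only. -/
theorem reachable_within_component {V : Type*} {G : SimpleGraph V} {X : Set V} {u a : V}
    (h : (within G X).Reachable u a) :
    (within G {z | (within G X).Reachable u z}).Reachable u a := by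
  rw [SimpleGraph.reachable_iff_reflTransGen] at h
  induction h with
  | refl => rfl
  | @tail b c hub hbc ih =>
    have hub' : (within G X).Reachable u b := SimpleGraph.reachable_iff_reflTransGen _ _ |>.2 hub
    exact ih.trans (SimpleGraph.Adj.reachable ⟨hbc.1, hub', hub'.trans hbc.reachable⟩)

/-- A geodesic has no chords. -/
theorem walk_index_le_of_adj {V : Type*} {G : SimpleGraph V} {x y : V} {p : G.Walk x y}
    (hp : p.length = G.dist x y) {i j : ℕ} (hj : j ≤ p.length)
    (h : G.Adj (p.getVert i) (p.getVert j)) : j ≤ i + 1 := by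
  by_contra hlt
  have := SimpleGraph.dist_le ((p.take i).append (SimpleGraph.Walk.cons h (p.drop j)))
  rw [SimpleGraph.Walk.length_append, SimpleGraph.Walk.length_cons, SimpleGraph.Walk.take_length,
    SimpleGraph.Walk.drop_length] at this
  omega

/-- A shortest path from `x` to `y` has no chords, and its interior lies in `D`, away from the
neighbours of `v`. If `x` and `y` were not adjacent, closing it up through `v` would give an induced
cycle of length at least four. -/
theorem IsChordal.adj_of_reachable_within {V : Type*} {G : SimpleGraph V} (hG : IsChordal G)
    {v x y : V} {D : Set V} (hD : ∀ d ∈ D, d ≠ v ∧ ¬ G.Adj v d) (hx : G.Adj v x) (hy : G.Adj v y)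
    (hxy : x ≠ y) (hr : (within G (insert x (insert y D))).Reachable x y) : G.Adj x y := by
  by_contra hnadj
  set G' := within G (insert x (insert y D)) with hG'
  obtain ⟨p, hp⟩ := hr.exists_walk_length_eq_dist
  have hpath := p.isPath_of_length_eq_dist hp
  have hinj := (SimpleGraph.Walk.IsPath.getVert_injOn_iff p).2 hpath
  set d := p.length with hd
  have hmem : ∀ i, p.getVert i ∈ insert x (insert y D) := fun i =>
    mem_of_reachable_within (G := G) (X := insert x (insert y D)) (by simp) ⟨p.take i⟩
  have hd2 : 2 ≤ d := by
    rw [hp]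
    exact hr.one_lt_dist_of_ne_of_not_adj hxy fun h => hnadj h.1
  have hadj : ∀ i j, i ≤ d → j ≤ d →
      (G.Adj (p.getVert i) (p.getVert j) ↔ i = j + 1 ∨ j = i + 1) := by
    intro i j hi hj
    constructor
    · intro h
      have h1 : G'.Adj (p.getVert i) (p.getVert j) := ⟨h, hmem i, hmem j⟩
      have h2 := walk_index_le_of_adj hp hj h1
      have h3 := walk_index_le_of_adj hp hi h1.symm
      have h4 : i ≠ j := by rintro rfl; exact G.loopless.irrefl _ h
      omega
    · rintro (rfl | rfl)
      · exact (p.adj_getVert_succ (i := j) (by omega)).1.symm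
      · exact (p.adj_getVert_succ (i := i) (by omega)).1
  have hvD : ∀ i, 0 < i → i < d → p.getVert i ∈ D := by
    intro i h0 hi
    have h1 : p.getVert i ≠ x := by
      intro h
      have := hinj (show i ∈ {i | i ≤ p.length} from hi.le) (show 0 ∈ {i | i ≤ p.length} by simp)
        (by rw [h, p.getVert_zero])
      omega
    have h2 : p.getVert i ≠ y := by
      intro h
      have := hinj (show i ∈ {i | i ≤ p.length} from hi.le)
        (show d ∈ {i | i ≤ p.length} by simp [hd]) (by rw [h, hd, p.getVert_length])
      omega
    rcases hmem i with h | h | h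
    · exact absurd h h1
    · exact absurd h h2
    · exact h
  have hvadj : ∀ i, i ≤ d → (G.Adj v (p.getVert i) ↔ i = 0 ∨ i = d) := by
    intro i hi
    constructor
    · intro h
      by_contra hne
      exact (hD _ (hvD i (by omega) (by omega))).2 h
    · rintro (rfl | rfl)
      · rwa [p.getVert_zero]
      · rwa [hd, p.getVert_length]
  have hvne : ∀ i, i ≤ d → p.getVert i ≠ v := by
    intro i hi h
    by_cases hi' : i = 0 ∨ i = d
    · exact G.loopless.irrefl _ (h ▸ (hvadj i hi).2 hi')
    · exact (hD _ (hvD i (by omega) (by omega))).1 h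
  -- Vertex `0` of the cycle is `v`, and vertex `i > 0` is position `i - 1` of the path.
  refine hG (d + 2) (by omega) ⟨⟨⟨fun i => if i.1 = 0 then v else p.getVert (i.1 - 1), ?_⟩, ?_⟩⟩
  · rintro ⟨i, hi⟩ ⟨j, hj⟩ h
    simp only at h
    split_ifs at h with h1 h2 h2
    · exact Fin.ext (by simp; omega)
    · exact absurd h.symm (hvne _ (by omega))
    · exact absurd h (hvne _ (by omega))
    · have := hinj (show i - 1 ∈ {i | i ≤ p.length} by simp; omega)
        (show j - 1 ∈ {i | i ≤ p.length} by simp; omega) h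
      exact Fin.ext (by simp; omega)
  · rintro ⟨i, hi⟩ ⟨j, hj⟩
    rw [SimpleGraph.cycleGraph_adj']
    -- Subtraction in `Fin (d + 2)` wraps around; the second alternative is the closing edge between
    -- `v` and `y`.
    have hsub : ∀ a b (ha : a < d + 2) (hb : b < d + 2),
        ((⟨a, ha⟩ - ⟨b, hb⟩ : Fin (d + 2)).val = 1 ↔ a = b + 1 ∨ (a = 0 ∧ b = d + 1)) := by
      intro a b ha hb
      rw [Fin.sub_def]
      simp only
      rcases lt_or_ge b a with h | h
      · rw [show d + 2 - b + a = (a - b) + (d + 2) by omega, Nat.add_mod_right,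
          Nat.mod_eq_of_lt (by omega)]
        omega
      · rcases h.eq_or_lt with h | h
        · subst h
          rw [show d + 2 - a + a = d + 2 by omega, Nat.mod_self]
          omega
        · rw [Nat.mod_eq_of_lt (by omega)]
          omega
    rw [hsub, hsub]
    change G.Adj (if i = 0 then v else p.getVert (i - 1))
      (if j = 0 then v else p.getVert (j - 1)) ↔ _
    split_ifs with h1 h2 h2
    · simp only [SimpleGraph.irrefl, false_iff]
      omega
    · rw [hvadj _ (by omega)]
      omega
    · rw [G.adj_comm, hvadj _ (by omega)]
      omega
    · rw [hadj _ _ (by omega) (by omega)]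
      omega

/-- Every clique `K ≠ X` misses a simplicial vertex of the subgraph induced by `X`. -/
theorem IsChordal.exists_simplicial {V : Type*} [Finite V] {G : SimpleGraph V} (hG : IsChordal G)
    (X K : Set V) (hKX : K ⊆ X) (hK : K.Pairwise G.Adj) (hne : K ≠ X) :
    ∃ w ∈ X, w ∉ K ∧ {a | a ∈ X ∧ G.Adj w a}.Pairwise G.Adj := by
  induction hn : X.ncard using Nat.strong_induction_on generalizing X K with
  | _ n ih =>
  by_cases hcomp : X.Pairwise G.Adj
  · obtain ⟨w, hwX, hwK⟩ := Set.exists_of_ssubset (hKX.ssubset_of_ne hne)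
    exact ⟨w, hwX, hwK, hcomp.mono fun a ha => ha.1⟩
  -- The vertex `v` must have a non-neighbour, but none in `K`. A vertex of `K` with a non-neighbour
  -- will do; if there is none, `K` is joined to all of `X`, and any vertex with a non-neighbour
  -- will do.
  obtain ⟨v, hvX, u, huX, huv, hnuv, hvK⟩ : ∃ v ∈ X, ∃ u ∈ X, u ≠ v ∧ ¬ G.Adj v u ∧
      ∀ w ∈ X, w ≠ v → ¬ G.Adj v w → w ∉ K := by
    by_cases h : ∃ k ∈ K, ∃ u ∈ X, u ≠ k ∧ ¬ G.Adj k u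
    · obtain ⟨k, hk, u, hu, huk, hn⟩ := h
      exact ⟨k, hKX hk, u, hu, huk, hn, fun w _ hwk hn hw => hn (hK hk hw hwk.symm)⟩
    · push Not at h
      simp only [Set.Pairwise] at hcomp
      push Not at hcomp
      obtain ⟨v, hv, u, hu, hvu, hn⟩ := hcomp
      exact ⟨v, hv, u, hu, hvu.symm, hn, fun w _ hwv hn hw => hn (h w hw v hv hwv.symm).symm⟩
  set Z : Set V := {z | z ∈ X ∧ z ≠ v ∧ ¬ G.Adj v z} with hZ
  set D : Set V := {z | (within G Z).Reachable u z} with hD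
  have huZ : u ∈ Z := ⟨huX, huv, hnuv⟩
  have huD : u ∈ D := SimpleGraph.Reachable.refl _
  have hDZ : D ⊆ Z := fun z hz => mem_of_reachable_within huZ hz
  -- `S` is the boundary of the component `D` of `u` among the non-neighbours of `v`. All of `S` is
  -- adjacent to `v`, and any two of its vertices are linked through `D`, so `S` is a clique.
  set S : Set V := {s | s ∈ X ∧ s ∉ D ∧ ∃ d ∈ D, G.Adj s d} with hS
  have hSv : ∀ s ∈ S, G.Adj v s := by
    rintro s ⟨hsX, hsD, d, hd, hsd⟩
    by_contra hvs
    refine hsD (SimpleGraph.Reachable.trans hd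
      (SimpleGraph.Adj.reachable ⟨hsd.symm, hDZ hd, hsX, ?_, hvs⟩))
    rintro rfl
    exact (hDZ hd).2.2 hsd
  have hSc : S.Pairwise G.Adj := by
    rintro x hx y hy hxy
    refine hG.adj_of_reachable_within (v := v) (D := D) (fun d hd => (hDZ hd).2) (hSv x hx)
      (hSv y hy) hxy ?_
    obtain ⟨-, -, a, ha, hxa⟩ := hx
    obtain ⟨-, -, b, hb, hyb⟩ := hy
    have hsub : within G D ≤ within G (insert x (insert y D)) :=
      within_mono ((Set.subset_insert _ _).trans (Set.subset_insert _ _))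
    have hab := (((reachable_within_component ha).symm.trans
      (reachable_within_component hb))).mono hsub
    have hxa' : (within G (insert x (insert y D))).Adj x a := ⟨hxa, by simp, by simp [ha]⟩
    have hby' : (within G (insert x (insert y D))).Adj b y := ⟨hyb.symm, by simp [hb], by simp⟩
    exact hxa'.reachable.trans (hab.trans hby'.reachable)
  have hlt : (D ∪ S).ncard < n := by
    rw [← hn]
    refine Set.ncard_lt_ncard ((Set.ssubset_iff_of_subset ?_).2 ⟨v, hvX, ?_⟩) (Set.toFinite _)
    · exact Set.union_subset (fun z hz => (hDZ hz).1) fun z hz => hz.1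
    · rintro (h | h)
      · exact (hDZ h).2.1 rfl
      · exact G.loopless.irrefl _ (hSv v h)
  -- A simplicial vertex of `D ∪ S` outside `S` lies in `D`, so all its neighbours in `X` are
  -- already in `D ∪ S`, and it is simplicial in `X`.
  obtain ⟨w, hw, hwS, hwc⟩ := ih _ hlt (D ∪ S) S Set.subset_union_right hSc
    (fun h => (h ▸ Set.mem_union_left S huD : u ∈ S).2.1 huD) rfl
  have hwD : w ∈ D := hw.resolve_right hwS
  have hwZ := hDZ hwD
  refine ⟨w, hwZ.1, hvK w hwZ.1 hwZ.2.1 hwZ.2.2, hwc.mono ?_⟩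
  rintro a ⟨haX, hwa⟩
  refine ⟨?_, hwa⟩
  by_cases haD : a ∈ D
  · exact Or.inl haD
  · exact Or.inr ⟨haX, haD, w, hwD, hwa.symm⟩

/-- A perfect elimination ordering which ends with the clique `K`, as a rank function on `X`. -/
theorem IsChordal.exists_rank {V : Type*} [Finite V] {G : SimpleGraph V} (hG : IsChordal G)
    (X K : Set V) (hKX : K ⊆ X) (hK : K.Pairwise G.Adj) :
    ∃ f : V → ℕ, Set.InjOn f X ∧ (∀ k ∈ K, ∀ x ∈ X, x ∉ K → f k < f x) ∧
      ∀ a ∈ X, ∀ b ∈ X, ∀ c ∈ X, a ≠ c → G.Adj a b → G.Adj c b → f a < f b → f c < f b →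
        G.Adj a c := by
  classical
  induction hn : X.ncard using Nat.strong_induction_on generalizing X with
  | _ n ih =>
  by_cases hne : K = X
  · obtain ⟨f, hf⟩ := Countable.exists_injective_nat V
    subst hne
    exact ⟨f, hf.injOn, fun k _ x hx hxK => absurd hx hxK,
      fun a ha b _ c hc hac _ _ _ _ => hK ha hc hac⟩
  obtain ⟨w, hwX, hwK, hw⟩ := hG.exists_simplicial X K hKX hK hne
  have hsub : K ⊆ X \ {w} := fun k hk => ⟨hKX hk, fun h => hwK (h ▸ hk)⟩
  obtain ⟨f, hf, hfK, hfc⟩ := ih _ (hn ▸ Set.ncard_sdiff_singleton_lt_of_mem hwX (Set.toFinite _))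
    (X \ {w}) hsub rfl
  obtain ⟨m, hm⟩ := (Set.finite_range f).bddAbove
  have hm' : ∀ x, f x < m + 1 := fun x => Nat.lt_succ_of_le (hm ⟨x, rfl⟩)
  -- The simplicial vertex is ranked last, above every value of `f`.
  refine ⟨Function.update f w (m + 1), ?_, ?_, ?_⟩
  · intro a ha b hb hab
    by_cases haw : a = w <;> by_cases hbw : b = w
    · rw [haw, hbw]
    · subst haw
      rw [Function.update_self, Function.update_of_ne hbw] at hab
      exact absurd hab (hm' b).ne'
    · subst hbw
      rw [Function.update_self, Function.update_of_ne haw] at hab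
      exact absurd hab (hm' a).ne
    · rw [Function.update_of_ne haw, Function.update_of_ne hbw] at hab
      exact hf ⟨ha, haw⟩ ⟨hb, hbw⟩ hab
  · intro k hk x hx hxK
    have hkw : k ≠ w := fun h => hwK (h ▸ hk)
    rw [Function.update_of_ne hkw]
    by_cases hxw : x = w
    · subst hxw
      rw [Function.update_self]
      exact hm' k
    · rw [Function.update_of_ne hxw]
      exact hfK k hk x ⟨hx, hxw⟩ hxK
  · intro a ha b hb c hc hac hab hcb hfa hfc'
    by_cases hbw : b = w
    · subst hbw
      exact hw ⟨ha, hab.symm⟩ ⟨hc, hcb.symm⟩ hac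
    · rw [Function.update_of_ne hbw] at hfa hfc'
      have haw : a ≠ w := by
        rintro rfl
        rw [Function.update_self] at hfa
        exact absurd hfa (hm' b).not_gt
      have hcw : c ≠ w := by
        rintro rfl
        rw [Function.update_self] at hfc'
        exact absurd hfc' (hm' b).not_gt
      rw [Function.update_of_ne haw] at hfa
      rw [Function.update_of_ne hcw] at hfc'
      exact hfc a ⟨ha, haw⟩ b ⟨hb, hbw⟩ c ⟨hc, hcw⟩ hac hab hcb hfa hfc'

/-! ### Existence of clique trees -/

/-- `K` is a maximal clique of the subgraph of `G` induced by `X`. -/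
abbrev IsMaxCliqueWithin {V : Type*} (G : SimpleGraph V) (X K : Set V) : Prop :=
  Maximal (fun K' : Set V => K' ⊆ X ∧ K'.Pairwise G.Adj) K

theorem exists_isMaxCliqueWithin_ge {V : Type*} [Finite V] {G : SimpleGraph V} {X S : Set V}
    (hSX : S ⊆ X) (hS : S.Pairwise G.Adj) : ∃ K, IsMaxCliqueWithin G X K ∧ S ⊆ K := by
  obtain ⟨K, hSK, hK⟩ := Finite.exists_le_maximal
    (p := fun K' : Set V => K' ⊆ X ∧ K'.Pairwise G.Adj) ⟨hSX, hS⟩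
  exact ⟨K, hK, hSK⟩

/-- Every clique through `w` lies in its closed neighbourhood, which is itself a clique. Deleting
`w` leaves the other maximal cliques maximal and can create only one new one, the open
neighbourhood. -/
theorem isMaxCliqueWithin_iff_of_simplicial {V : Type*} {G : SimpleGraph V} {X : Set V}
    {w : V} (hwX : w ∈ X) (hw : {a | a ∈ X ∧ G.Adj w a}.Pairwise G.Adj) (K : Set V) :
    IsMaxCliqueWithin G X K ↔ K = insert w {a | a ∈ X ∧ G.Adj w a} ∨
      IsMaxCliqueWithin G (X \ {w}) K ∧ K ≠ {a | a ∈ X ∧ G.Adj w a} := by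
  set S := {a | a ∈ X ∧ G.Adj w a} with hS
  have hwS : w ∉ S := fun h => G.loopless.irrefl _ h.2
  have hins : (insert w S).Pairwise G.Adj := by
    intro a ha b hb hab
    rcases ha with rfl | ha <;> rcases hb with rfl | hb
    · exact absurd rfl hab
    · exact hb.2
    · exact ha.2.symm
    · exact hw ha hb hab
  have hinsX : insert w S ⊆ X := Set.insert_subset hwX fun a ha => ha.1
  have hle : ∀ K : Set V, K ⊆ X → K.Pairwise G.Adj → w ∈ K → K ⊆ insert w S := by
    intro K hKX hK hwK a ha
    by_cases haw : a = w
    · exact Or.inl haw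
    · exact Or.inr ⟨hKX ha, hK hwK ha (Ne.symm haw)⟩
  have hdiff : ∀ K : Set V, K ⊆ X → w ∉ K → K ⊆ X \ {w} := fun K hKX hwK a ha =>
    ⟨hKX ha, fun h => hwK (h ▸ ha)⟩
  constructor
  · intro hK
    by_cases hwK : w ∈ K
    · exact Or.inl (hK.eq_of_le ⟨hinsX, hins⟩ (hle K hK.prop.1 hK.prop.2 hwK))
    · refine Or.inr ⟨⟨⟨hdiff K hK.prop.1 hwK, hK.prop.2⟩, fun K' hK' hKK' =>
        hK.le_of_ge ⟨fun a ha => (hK'.1 ha).1, hK'.2⟩ hKK'⟩, ?_⟩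
      rintro rfl
      exact hwK (hK.le_of_ge ⟨hinsX, hins⟩ (Set.subset_insert _ _) (Set.mem_insert _ _))
  · rintro (rfl | ⟨hK, hKS⟩)
    · exact ⟨⟨hinsX, hins⟩, fun K' hK' hle' => hle K' hK'.1 hK'.2 (hle' (Set.mem_insert _ _))⟩
    · refine ⟨⟨fun a ha => (hK.prop.1 ha).1, hK.prop.2⟩, fun K' hK' hKK' => ?_⟩
      by_cases hwK' : w ∈ K'
      · refine absurd (hK.eq_of_le ⟨hdiff S (fun a ha => ha.1) hwS, hw⟩ ?_) hKS
        intro a ha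
        exact (hle K' hK'.1 hK'.2 hwK' (hKK' ha)).resolve_left fun h =>
          (hK.prop.1 ha).2 h
      · exact hK.le_of_ge ⟨hdiff K' hK'.1 hwK', hK'.2⟩ hKK'

/-- A clique tree of the subgraph of `G` induced by `X`, whose nodes are the vertices in `N`, given
by the parent function `p`. -/
structure IsParentCliqueTree {V : Type*} (G : SimpleGraph V) (X N : Set V) (ι : V → Set V) (r : V)
    (p : V → V) (ρ : V → ℕ) : Prop where
  subset : N ⊆ X
  bijOn : Set.BijOn ι N {K | IsMaxCliqueWithin G X K}
  root : r ∈ N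
  parent : ∀ x ∈ N, x ≠ r → p x ∈ N ∧ ρ (p x) < ρ x
  top : ∀ v ∈ X, ∃ t ∈ N, v ∈ ι t ∧ ∀ x ∈ N, v ∈ ι x → x ≠ t → x ≠ r ∧ v ∈ ι (p x)

theorem reachable_within_diff_simplicial {V : Type*} {G : SimpleGraph V} {X : Set V}
    {w : V} (hw : {a | a ∈ X ∧ G.Adj w a}.Pairwise G.Adj) {a b : V} (haw : a ≠ w)
    (hbw : b ≠ w) (h : (within G X).Reachable a b) : (within G (X \ {w})).Reachable a b := by
  -- A walk can skip `w`, since its neighbours before and after `w` are equal or adjacent. The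
  -- second clause is the induction hypothesis for a walk that has just arrived at `w`.
  suffices ∀ c, (within G X).Reachable a c → (c ≠ w → (within G (X \ {w})).Reachable a c) ∧
      (c = w → ∀ s ∈ X, G.Adj w s → (within G (X \ {w})).Reachable a s) from (this b h).1 hbw
  intro c hc
  rw [SimpleGraph.reachable_iff_reflTransGen] at hc
  induction hc with
  | refl => exact ⟨fun _ => .rfl, fun h => absurd h haw⟩
  | @tail b c _ hbc ih =>
    obtain ⟨hadj, hbX, hcX⟩ := hbc
    by_cases hb : b = w
    · subst hb
      exact ⟨fun _ => ih.2 rfl c hcX hadj, fun h => absurd (h ▸ hadj) (G.loopless.irrefl _)⟩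
    · refine ⟨fun hc => (ih.1 hb).trans
        (SimpleGraph.Adj.reachable ⟨hadj, ⟨hbX, hb⟩, hcX, hc⟩), ?_⟩
      rintro rfl s hs hcs
      by_cases hbs : b = s
      · exact hbs ▸ ih.1 hb
      · exact (ih.1 hb).trans (SimpleGraph.Adj.reachable ⟨hw ⟨hbX, hadj.symm⟩ ⟨hs, hcs⟩ hbs,
          ⟨hbX, hb⟩, hs, fun h => G.loopless.irrefl _ (h ▸ hcs)⟩)

/-- Remove a simplicial vertex `w` with neighbourhood `S`. If `S` is a maximal clique of the rest,
its node is relabelled `S ∪ {w}`; otherwise `w` itself becomes a new leaf labelled `S ∪ {w}`, below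
a node whose clique contains `S`. Connectedness is kept in the form `top`: the nodes containing a
given vertex have a highest one, and every other passes the vertex on to its parent. The height `ρ`
rules out cycles of parents. -/
theorem IsChordal.exists_isParentCliqueTree {V : Type*} [Finite V] {G : SimpleGraph V}
    (hG : IsChordal G) (X : Set V) (hne : X.Nonempty)
    (hconn : ∀ a ∈ X, ∀ b ∈ X, (within G X).Reachable a b) :
    ∃ N ι r p ρ, IsParentCliqueTree G X N ι r p ρ := by
  classical
  induction hn : X.ncard using Nat.strong_induction_on generalizing X with
  | _ n ih =>
  obtain ⟨w, hwX, -, hw⟩ := hG.exists_simplicial X ∅ (Set.empty_subset _) (by simp)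
    hne.ne_empty.symm
  have hmax := isMaxCliqueWithin_iff_of_simplicial hwX hw
  set S := {a | a ∈ X ∧ G.Adj w a} with hS
  have hwS : w ∉ S := fun h => G.loopless.irrefl _ h.2
  have hSX : S ⊆ X \ {w} := fun a ha => ⟨ha.1, fun h => hwS (h ▸ ha)⟩
  rcases (X \ {w}).eq_empty_or_nonempty with hemp | hne'
  · have hX : ∀ v ∈ X, v = w := fun v hv => by
      by_contra h
      exact (hemp ▸ (⟨hv, h⟩ : v ∈ X \ {w}) : v ∈ (∅ : Set V)).elim
    have hS0 : S = ∅ := Set.subset_eq_empty (hemp ▸ hSX) rfl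
    refine ⟨{w}, fun _ => {w}, w, id, fun _ => 0, by simpa using hwX, ⟨?_, ?_, ?_⟩, rfl, ?_, ?_⟩
    · rintro x -
      exact (hmax _).2 (Or.inl (by simp [hS0]))
    · rintro x rfl y rfl -
      rfl
    · intro K hK
      rcases (hmax K).1 hK with h | ⟨h, h'⟩
      · exact ⟨w, rfl, by simp [h, hS0]⟩
      · exact absurd (Set.subset_eq_empty (hemp ▸ h.prop.1) rfl) (hS0 ▸ h')
    · rintro x rfl h
      exact absurd rfl h
    · intro v hv
      exact ⟨w, rfl, hX v hv, fun x hx _ h => absurd hx h⟩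
  have hconn' : ∀ a ∈ X \ {w}, ∀ b ∈ X \ {w}, (within G (X \ {w})).Reachable a b :=
    fun a ha b hb => reachable_within_diff_simplicial hw ha.2 hb.2 (hconn a ha.1 b hb.1)
  obtain ⟨N, ι, r, p, ρ, hT⟩ := ih _ (hn ▸ Set.ncard_sdiff_singleton_lt_of_mem hwX (Set.toFinite _))
    (X \ {w}) hne' hconn' rfl
  have hTmax : ∀ x ∈ N, IsMaxCliqueWithin G (X \ {w}) (ι x) := fun x hx => hT.bijOn.mapsTo hx
  have hwι : ∀ x ∈ N, w ∉ ι x := fun x hx h => ((hTmax x hx).prop.1 h).2 rfl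
  have hwN : w ∉ N := fun h => (hT.subset h).2 rfl
  by_cases hSmax : IsMaxCliqueWithin G (X \ {w}) S
  · obtain ⟨x₀, hx₀, hιx₀⟩ := hT.bijOn.surjOn hSmax
    have hmem : ∀ v x, v ≠ w → (v ∈ Function.update ι x₀ (insert w S) x ↔ v ∈ ι x) := by
      intro v x hv
      by_cases hx : x = x₀
      · subst hx
        simp [hιx₀, hv]
      · rw [Function.update_of_ne hx]
    refine ⟨N, Function.update ι x₀ (insert w S), r, p, ρ, fun x hx => (hT.subset hx).1,
      ⟨?_, ?_, ?_⟩, hT.root, hT.parent, ?_⟩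
    · intro x hx
      by_cases hxx : x = x₀
      · subst hxx
        rw [Function.update_self]
        exact (hmax _).2 (Or.inl rfl)
      · rw [Function.update_of_ne hxx]
        exact (hmax _).2 (Or.inr ⟨hT.bijOn.mapsTo hx, fun h =>
          hxx (hT.bijOn.injOn hx hx₀ (h.trans hιx₀.symm))⟩)
    · intro x hx y hy hxy
      by_cases hxx : x = x₀ <;> by_cases hyy : y = x₀
      · rw [hxx, hyy]
      · subst hxx
        rw [Function.update_self, Function.update_of_ne hyy] at hxy
        exact absurd (hxy ▸ Set.mem_insert w S) (hwι y hy)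
      · subst hyy
        rw [Function.update_self, Function.update_of_ne hxx] at hxy
        exact absurd (hxy ▸ Set.mem_insert w S) (hwι x hx)
      · rw [Function.update_of_ne hxx, Function.update_of_ne hyy] at hxy
        exact hT.bijOn.injOn hx hy hxy
    · intro K hK
      rcases (hmax K).1 hK with rfl | ⟨h, h'⟩
      · exact ⟨x₀, hx₀, Function.update_self _ _ _⟩
      · obtain ⟨x, hx, rfl⟩ := hT.bijOn.surjOn h
        refine ⟨x, hx, Function.update_of_ne ?_ _ _⟩
        rintro rfl
        exact h' hιx₀
    · intro v hv
      by_cases hvw : v = w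
      · subst hvw
        refine ⟨x₀, hx₀, by simp, fun x hx hvx hxx => ?_⟩
        rw [Function.update_of_ne hxx] at hvx
        exact absurd hvx (hwι x hx)
      · obtain ⟨t, ht, hvt, htop⟩ := hT.top v ⟨hv, hvw⟩
        refine ⟨t, ht, (hmem v t hvw).2 hvt, fun x hx hvx hxt => ?_⟩
        have := htop x hx ((hmem v x hvw).1 hvx) hxt
        exact ⟨this.1, (hmem v _ hvw).2 this.2⟩
  · obtain ⟨K₀, hK₀, hSK₀⟩ := exists_isMaxCliqueWithin_ge hSX hw
    obtain ⟨x₀, hx₀, rfl⟩ := hT.bijOn.surjOn hK₀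
    have hne : ∀ x ∈ N, x ≠ w := fun x hx h => hwN (h ▸ hx)
    have hιne : ∀ x ∈ N, Function.update ι w (insert w S) x = ι x := fun x hx =>
      Function.update_of_ne (hne x hx) _ _
    refine ⟨insert w N, Function.update ι w (insert w S), r, Function.update p w x₀,
      Function.update ρ w (ρ x₀ + 1), ?_, ⟨?_, ?_, ?_⟩, Or.inr hT.root, ?_, ?_⟩
    · exact Set.insert_subset hwX fun x hx => (hT.subset hx).1
    · rintro x (rfl | hx)
      · rw [Function.update_self]
        exact (hmax _).2 (Or.inl rfl)
      · rw [hιne x hx]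
        refine (hmax _).2 (Or.inr ⟨hT.bijOn.mapsTo hx, fun h => hSmax ?_⟩)
        exact h ▸ hT.bijOn.mapsTo hx
    · rintro x (rfl | hx) y (rfl | hy) hxy
      · rfl
      · rw [Function.update_self, hιne y hy] at hxy
        exact absurd (hxy ▸ Set.mem_insert x S) (hwι y hy)
      · rw [Function.update_self, hιne x hx] at hxy
        exact absurd (hxy ▸ Set.mem_insert y S) (hwι x hx)
      · rw [hιne x hx, hιne y hy] at hxy
        exact hT.bijOn.injOn hx hy hxy
    · intro K hK
      rcases (hmax K).1 hK with rfl | ⟨h, h'⟩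
      · exact ⟨w, Or.inl rfl, Function.update_self _ _ _⟩
      · obtain ⟨x, hx, rfl⟩ := hT.bijOn.surjOn h
        exact ⟨x, Or.inr hx, hιne x hx⟩
    · rintro x (rfl | hx) hxr
      · rw [Function.update_self, Function.update_self, Function.update_of_ne (hne x₀ hx₀)]
        exact ⟨Or.inr hx₀, Nat.lt_succ_self _⟩
      · have := hT.parent x hx hxr
        rw [Function.update_of_ne (hne x hx), Function.update_of_ne (hne x hx),
          Function.update_of_ne (hne _ this.1)]
        exact ⟨Or.inr this.1, this.2⟩
    · intro v hv
      by_cases hvw : v = w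
      · subst hvw
        refine ⟨v, Or.inl rfl, by simp, ?_⟩
        rintro x (rfl | hx) hvx hxv
        · exact absurd rfl hxv
        · rw [hιne x hx] at hvx
          exact absurd hvx (hwι x hx)
      · obtain ⟨t, ht, hvt, htop⟩ := hT.top v ⟨hv, hvw⟩
        refine ⟨t, Or.inr ht, by rwa [hιne t ht], ?_⟩
        rintro x (rfl | hx) hvx hxt
        · rw [Function.update_self] at hvx
          refine ⟨(hne r hT.root).symm, ?_⟩
          rw [Function.update_self, hιne x₀ hx₀]
          exact hSK₀ (hvx.resolve_left hvw)
        · rw [hιne x hx] at hvx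
          have := htop x hx hvx hxt
          rw [Function.update_of_ne (hne x hx), hιne _ (hT.parent x hx this.1).1]
          exact this

/-- The tree with root `r` and parent function `p`. -/
def parentGraph {N : Type*} (r : N) (p : N → N) : SimpleGraph N :=
  SimpleGraph.fromRel fun x y => x ≠ r ∧ y = p x

theorem parentGraph_adj {N : Type*} {r : N} {p : N → N} {ρ : N → ℕ}
    (hρ : ∀ x, x ≠ r → ρ (p x) < ρ x) {x : N} (hx : x ≠ r) : (parentGraph r p).Adj x (p x) := by
  refine ⟨fun h => ?_, Or.inl ⟨hx, rfl⟩⟩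
  have := hρ x hx
  rw [← h] at this
  exact absurd this (lt_irrefl _)

/-- Climbing along parents stays in `S` and decreases `ρ`, so it can stop only at `t`. -/
theorem parentGraph_induce_connected {N : Type*} {r : N} {p : N → N} {ρ : N → ℕ}
    (hρ : ∀ x, x ≠ r → ρ (p x) < ρ x) (S : Set N) (t : N) (ht : t ∈ S)
    (hS : ∀ x ∈ S, x ≠ t → x ≠ r ∧ p x ∈ S) : ((parentGraph r p).induce S).Connected := by
  have key : ∀ n, ∀ x, ∀ hx : x ∈ S, ρ x = n →
      ((parentGraph r p).induce S).Reachable ⟨t, ht⟩ ⟨x, hx⟩ := by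
    intro n
    induction n using Nat.strong_induction_on with
    | _ n ih =>
    intro x hx hn
    by_cases hxt : x = t
    · subst hxt
      rfl
    · obtain ⟨hxr, hpx⟩ := hS x hx hxt
      refine (ih _ (hn ▸ hρ x hxr) (p x) hpx rfl).trans (SimpleGraph.Adj.reachable ?_)
      exact (parentGraph_adj hρ hxr).symm
  have : Nonempty S := ⟨⟨t, ht⟩⟩
  exact ⟨fun a b => (key _ a.1 a.2 rfl).symm.trans (key _ b.1 b.2 rfl)⟩

/-- The map `x ↦ {x, p x}` is a bijection from the non-root nodes to the edges, so there is one edge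
fewer than nodes. Injectivity holds because two nodes cannot be each other's parents, by `ρ`. -/
theorem parentGraph_isTree {N : Type*} [Finite N] {r : N} {p : N → N} {ρ : N → ℕ}
    (hρ : ∀ x, x ≠ r → ρ (p x) < ρ x) : (parentGraph r p).IsTree := by
  classical
  rw [SimpleGraph.isTree_iff_connected_and_card]
  constructor
  · have h := parentGraph_induce_connected hρ Set.univ r trivial fun x _ hx => ⟨hx, trivial⟩
    exact (SimpleGraph.induceUnivIso _).connected_iff.1 h
  · have e : {x : N // x ≠ r} ≃ (parentGraph r p).edgeSet := by
      refine Equiv.ofBijective (fun x => ⟨s(x.1, p x.1), parentGraph_adj hρ x.2⟩) ⟨?_, ?_⟩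
      · rintro ⟨x, hx⟩ ⟨y, hy⟩ h
        refine Subtype.ext ?_
        rcases Sym2.eq_iff.1 (congrArg Subtype.val h) with h | ⟨h1, h2⟩
        · exact h.1
        · change p x = y at h2
          change x = p y at h1
          have h3 := hρ x hx
          have h4 := hρ y hy
          rw [h2] at h3
          rw [← h1] at h4
          omega
      · rintro ⟨e, he⟩
        induction e using Sym2.ind with
        | _ x y =>
        have hadj : (parentGraph r p).Adj x y := he
        rcases hadj.2 with ⟨hx, hxy⟩ | ⟨hy, hxy⟩
        · exact ⟨⟨x, hx⟩, Subtype.ext (congrArg (fun z => s(x, z)) hxy.symm)⟩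
        · exact ⟨⟨y, hy⟩, Subtype.ext
            (Sym2.eq_swap.trans (congrArg (fun z => s(z, y)) hxy.symm))⟩
    rw [← Nat.card_congr e, ← Nat.card_congr (Equiv.optionSubtypeNe r), Finite.card_option]

theorem maxCliques_eq {V : Type*} {G : SimpleGraph V} {H : G.Subgraph} (hH : H.IsInduced) :
    maxCliques H = {K | IsMaxCliqueWithin G H.verts K} := by
  have : (fun K' : Set V => K' ⊆ H.verts ∧ K'.Pairwise H.Adj) =
      fun K' : Set V => K' ⊆ H.verts ∧ K'.Pairwise G.Adj := by
    funext K'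
    refine propext (and_congr_right fun hK' => ⟨fun h => h.mono' fun _ _ h => h.adj_sub, ?_⟩)
    exact fun h a ha b hb hab => hH (hK' ha) (hK' hb) (h ha hb hab)
  rw [maxCliques, this]

theorem spanningCoe_eq_within {V : Type*} {G : SimpleGraph V} {H : G.Subgraph} (hH : H.IsInduced) :
    H.spanningCoe = within G H.verts := by
  ext a b
  exact ⟨fun h : H.Adj a b => ⟨h.adj_sub, H.edge_vert h, H.edge_vert h.symm⟩,
    fun h => hH h.2.1 h.2.2 h.1⟩

theorem reachable_within_of_connected {V : Type*} {G : SimpleGraph V} {H : G.Subgraph}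
    (hconn : H.Connected) {a b : V} (ha : a ∈ H.verts) (hb : b ∈ H.verts) :
    (within G H.verts).Reachable a b := by
  have h := hconn.preconnected.coe ⟨a, ha⟩ ⟨b, hb⟩
  exact h.map (⟨Subtype.val, fun {x y} h => ⟨h.adj_sub, x.2, y.2⟩⟩ : H.coe →g within G H.verts)

/-- Connected chordal graphs have rooted clique trees. -/
theorem IsChordal.nonempty_rootedCliqueTree {V : Type*} [Finite V] {G : SimpleGraph V}
    (hG : IsChordal G) {H : G.Subgraph} (hH : H.IsInduced) (hconn : H.Connected) :
    Nonempty (RootedCliqueTree H) := by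
  obtain ⟨N, ι, r, p, ρ, hT⟩ := hG.exists_isParentCliqueTree H.verts hconn.nonempty
    fun a ha b hb => reachable_within_of_connected hconn ha hb
  classical
  let p' : N → N := fun x => if h : x.1 = r then ⟨r, hT.root⟩ else ⟨p x, (hT.parent x x.2 h).1⟩
  have hp' : ∀ x : N, x.1 ≠ r → (p' x).1 = p x := fun x h => by simp [p', h]
  have hne : ∀ x : N, x ≠ ⟨r, hT.root⟩ → x.1 ≠ r := fun x h h' => h (Subtype.ext h')
  have hρ : ∀ x : N, x ≠ ⟨r, hT.root⟩ → ρ (p' x) < ρ x := by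
    intro x hx
    rw [hp' x (hne x hx)]
    exact (hT.parent x x.2 (hne x hx)).2
  refine ⟨⟨N, parentGraph ⟨r, hT.root⟩ p', parentGraph_isTree (ρ := fun x => ρ x) hρ, ⟨r, hT.root⟩,
    fun x => ι x, ?_, ?_⟩⟩
  · rw [maxCliques_eq hH]
    refine ⟨fun x _ => hT.bijOn.mapsTo x.2, fun x _ y _ h => Subtype.ext (hT.bijOn.injOn x.2 y.2 h),
      fun K hK => ?_⟩
    obtain ⟨x, hx, rfl⟩ := hT.bijOn.surjOn hK
    exact ⟨⟨x, hx⟩, trivial, rfl⟩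
  · intro v hv
    obtain ⟨t, ht, hvt, htop⟩ := hT.top v hv
    refine parentGraph_induce_connected (ρ := fun x : N => ρ x) hρ _ ⟨t, ht⟩ hvt fun x hx hxt => ?_
    have := htop x x.2 hx fun h => hxt (Subtype.ext h)
    exact ⟨fun h => this.1 (congrArg Subtype.val h), by
      change v ∈ ι (p' x).1
      rw [hp' x this.1]
      exact this.2⟩

/-! ### Acyclic moral orientations -/

theorem IsAcyclic.wellFounded {V : Type*} [Finite V] {α : Digraph V} (h : IsAcyclic α) :
    WellFounded α.Adj := by
  have : Std.Irrefl (Relation.TransGen α.Adj) := ⟨h⟩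
  have hw : WellFounded (Relation.TransGen α.Adj) := Finite.wellFounded_of_trans_of_irrefl _
  exact hw.mono fun _ _ h => Relation.TransGen.single h

theorem IsAcyclic.exists_source {V : Type*} [Finite V] {α : Digraph V} (h : IsAcyclic α)
    {Y : Set V} (hY : Y.Nonempty) : ∃ y ∈ Y, ∀ x ∈ Y, ¬ α.Adj x y :=
  h.wellFounded.has_min Y hY

/-- The vertices lying on closed walks through `v` would form a set without a source. For glued
orientations, sources are easier to find than cycles are to exclude. -/
theorem isAcyclic_of_exists_source {V : Type*} {α : Digraph V}
    (h : ∀ Y : Set V, Y.Nonempty → ∃ y ∈ Y, ∀ x ∈ Y, ¬ α.Adj x y) : IsAcyclic α := by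
  intro v hv
  obtain ⟨y, hy, hsrc⟩ := h {x | Relation.TransGen α.Adj v x ∧ Relation.TransGen α.Adj x v}
    ⟨v, hv, hv⟩
  obtain ⟨z, hz, hzy⟩ := Relation.TransGen.tail'_iff.1 hy.1
  refine hsrc z ⟨?_, Relation.TransGen.head hzy hy.2⟩ hzy
  rcases Relation.reflTransGen_iff_eq_or_transGen.1 hz with rfl | h
  · exact hv
  · exact h

theorem IsAcyclic.mono {V : Type*} {α β : Digraph V} (h : IsAcyclic β) (hle : α ≤ β) :
    IsAcyclic α :=
  fun v hv => h v (Relation.TransGen.mono (fun _ _ h => hle h) _ _ hv)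

theorem IsAMO.adj {V : Type*} {Γ : SimpleGraph V} {α : Digraph V} (h : IsAMO Γ α) {a b : V}
    (hab : α.Adj a b) : Γ.Adj a b :=
  (h.orientation.1 a b).2 (Or.inl hab)

theorem IsAMO.adj_or {V : Type*} {Γ : SimpleGraph V} {α : Digraph V} (h : IsAMO Γ α) {a b : V}
    (hab : Γ.Adj a b) : α.Adj a b ∨ α.Adj b a :=
  (h.orientation.1 a b).1 hab

theorem IsAMO.not_adj_symm {V : Type*} {Γ : SimpleGraph V} {α : Digraph V} (h : IsAMO Γ α) {a b : V}
    (hab : α.Adj a b) : ¬ α.Adj b a :=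
  h.orientation.2 a b hab

theorem IsAMO.adj_of_adj_of_adj {V : Type*} {Γ : SimpleGraph V} {α : Digraph V} (h : IsAMO Γ α)
    {a b c : V} (hac : a ≠ c) (hab : α.Adj a b) (hcb : α.Adj c b) : Γ.Adj a c :=
  (h.orientation.1 a c).2 (h.moral a b c hac hab hcb)

/-- Criterion for AMOs in which the underlying graph replaces the symmetrized orientation. -/
theorem IsAMO.of_graph {V : Type*} {Γ : SimpleGraph V} {α : Digraph V}
    (ho : IsOrientation Γ α) (ha : IsAcyclic α)
    (hm : ∀ a b c, a ≠ c → α.Adj a b → α.Adj c b → Γ.Adj a c) : IsAMO Γ α :=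
  ⟨ho, ha, fun a b c hac hab hcb => (ho.1 a c).1 (hm a b c hac hab hcb)⟩

/-- The part of a digraph between vertices of `Y`. -/
def restrict {V : Type*} (α : Digraph V) (Y : Set V) : Digraph V where
  Adj a b := α.Adj a b ∧ a ∈ Y ∧ b ∈ Y

theorem IsAMO.restrict {V : Type*} {G : SimpleGraph V} {X Y : Set V} (hYX : Y ⊆ X) {α : Digraph V}
    (h : IsAMO (within G X) α) : IsAMO (within G Y) (restrict α Y) := by
  refine IsAMO.of_graph ⟨fun a b => ⟨fun hab => ?_, ?_⟩, fun a b hab hba =>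
    h.not_adj_symm hab.1 hba.1⟩ (h.acyclic.mono fun _ _ hab => hab.1) ?_
  · exact (h.adj_or ⟨hab.1, hYX hab.2.1, hYX hab.2.2⟩).imp (fun h => ⟨h, hab.2⟩)
      fun h => ⟨h, hab.2.symm⟩
  · rintro (hab | hab)
    · exact ⟨(h.adj hab.1).1, hab.2⟩
    · exact ⟨(h.adj hab.1).1.symm, hab.2.symm⟩
  · intro a b c hac hab hcb
    exact ⟨(h.adj_of_adj_of_adj hac hab.1 hcb.1).1, hab.2.1, hcb.2.1⟩

/-- The orientation of `Γ` from smaller to larger rank. -/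
def orientByRank {V : Type*} (Γ : SimpleGraph V) (f : V → ℕ) : Digraph V where
  Adj a b := Γ.Adj a b ∧ f a < f b

theorem isAMO_orientByRank {V : Type*} {Γ : SimpleGraph V} {f : V → ℕ}
    (hf : ∀ a b, Γ.Adj a b → f a ≠ f b)
    (hm : ∀ a b c, a ≠ c → Γ.Adj a b → Γ.Adj c b → f a < f b → f c < f b → Γ.Adj a c) :
    IsAMO Γ (orientByRank Γ f) := by
  refine IsAMO.of_graph ⟨fun a b => ⟨fun hab => ?_, ?_⟩, fun a b hab hba =>
    absurd hab.2 hba.2.not_gt⟩ (isAcyclic_of_exists_source fun Y hY => ?_) ?_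
  · exact (hf a b hab).lt_or_gt.imp (fun h => ⟨hab, h⟩) fun h => ⟨hab.symm, h⟩
  · rintro (hab | hab)
    · exact hab.1
    · exact hab.1.symm
  · obtain ⟨y, hy, hmin⟩ := (InvImage.wf f wellFounded_lt).has_min Y hY
    exact ⟨y, hy, fun x hx hxy => hmin x hx hxy.2⟩
  · exact fun a b c hac hab hcb => hm a b c hac hab.1 hcb.1 hab.2 hcb.2

/-- `K` is closed under taking parents. -/
def IsInitial {V : Type*} (α : Digraph V) (K : Set V) : Prop :=
  ∀ a b, α.Adj a b → b ∈ K → a ∈ K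

/-! ### Gluing orientations -/

/-- The edges of `Γ` inside the classes of `q`. -/
def classGraph {V κ : Type*} (Γ : SimpleGraph V) (q : V → κ) : SimpleGraph V where
  Adj a b := Γ.Adj a b ∧ q a = q b
  symm := ⟨fun _ _ h => ⟨h.1.symm, h.2.symm⟩⟩
  loopless := ⟨fun _ h => Γ.loopless.irrefl _ h.1⟩

/-- The digraph that agrees with `γ` inside the classes of `q` and with `α` between them. -/
def glue {V κ : Type*} (q : V → κ) (α γ : Digraph V) : Digraph V where
  Adj a b := (q a = q b ∧ γ.Adj a b) ∨ (q a ≠ q b ∧ α.Adj a b)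

/-- By `hq`, an edge of `α` entering a class from outside comes from a common parent of the whole
class. Hence a `γ`-source in the class of an `α`-source of `Y` is a source of `Y`. In a collision `a
→ b ← c` with only `a` in the class of `b`, the edge `c → b` can be moved to `c → a`, so `a` and `c`
are adjacent. -/
theorem isAMO_glue {V κ : Type*} [Finite V] {Γ : SimpleGraph V} {q : V → κ} {α γ : Digraph V}
    (hα : IsAMO Γ α) (hγ : IsAMO (classGraph Γ q) γ)
    (hq : ∀ a b b', α.Adj a b → q a ≠ q b → q b' = q b → α.Adj a b') :
    IsAMO Γ (glue q α γ) := by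
  refine IsAMO.of_graph ⟨fun a b => ⟨fun hab => ?_, ?_⟩, ?_⟩
    (isAcyclic_of_exists_source fun Y hY => ?_) ?_
  · by_cases h : q a = q b
    · exact (hγ.adj_or ⟨hab, h⟩).imp (fun h' => Or.inl ⟨h, h'⟩) fun h' => Or.inl ⟨h.symm, h'⟩
    · exact (hα.adj_or hab).imp (fun h' => Or.inr ⟨h, h'⟩) fun h' => Or.inr ⟨Ne.symm h, h'⟩
  · rintro ((⟨-, h⟩ | ⟨-, h⟩) | (⟨-, h⟩ | ⟨-, h⟩))
    · exact (hγ.adj h).1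
    · exact hα.adj h
    · exact (hγ.adj h).1.symm
    · exact (hα.adj h).symm
  · rintro a b (⟨h1, h⟩ | ⟨h1, h⟩) (⟨h2, h'⟩ | ⟨h2, h'⟩)
    · exact hγ.not_adj_symm h h'
    · exact h2 h1.symm
    · exact h1 h2.symm
    · exact hα.not_adj_symm h h'
  · obtain ⟨y, hy, hmin⟩ := hα.acyclic.exists_source hY
    obtain ⟨z, ⟨hz, hzy⟩, hmin'⟩ := hγ.acyclic.exists_source
      (Y := {z | z ∈ Y ∧ q z = q y}) ⟨y, hy, rfl⟩
    refine ⟨z, hz, ?_⟩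
    rintro x hx (⟨hxz, h⟩ | ⟨hxz, h⟩)
    · exact hmin' x ⟨hx, hxz.trans hzy⟩ h
    · exact hmin x hx (hq x z y h hxz hzy.symm)
  · rintro a b c hac (⟨h1, h⟩ | ⟨h1, h⟩) (⟨h2, h'⟩ | ⟨h2, h'⟩)
    · exact (hγ.adj_of_adj_of_adj hac h h').1
    · exact (hα.adj (hq c b a h' h2 h1)).symm
    · exact hα.adj (hq a b c h h1 h2)
    · exact hα.adj_of_adj_of_adj hac h h'

/-! ### Topological orderings -/

theorem exists_topological_list {V : Type*} [Finite V] {α : Digraph V} (hα : IsAcyclic α)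
    (S : Set V) : ∃ l : List V, IsPermOf l S ∧ l.Pairwise fun a b => ¬ α.Adj b a := by
  induction hn : S.ncard using Nat.strong_induction_on generalizing S with
  | _ n ih =>
  rcases S.eq_empty_or_nonempty with rfl | hne
  · exact ⟨[], ⟨List.nodup_nil, by simp⟩, List.Pairwise.nil⟩
  · obtain ⟨y, hy, hmin⟩ := hα.exists_source hne
    obtain ⟨l, ⟨hnd, hl⟩, hpw⟩ := ih _
      (hn ▸ Set.ncard_sdiff_singleton_lt_of_mem hy (Set.toFinite _)) (S \ {y}) rfl
    have hmem : ∀ x, x ∈ l ↔ x ∈ S \ {y} := fun x => Set.ext_iff.1 hl x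
    refine ⟨y :: l, ⟨List.nodup_cons.2 ⟨fun h => ((hmem y).1 h).2 rfl, hnd⟩, ?_⟩,
      List.pairwise_cons.2 ⟨fun x hx => hmin x ((hmem x).1 hx).1, hpw⟩⟩
    ext x
    change x ∈ y :: l ↔ x ∈ S
    rw [List.mem_cons, hmem]
    by_cases h : x = y
    · simp [h, hy]
    · simp [h]

theorem pairwise_adj_of_clique {V : Type*} {Γ : SimpleGraph V} {α : Digraph V} (hα : IsAMO Γ α)
    {K : Set V} (hK : K.Pairwise Γ.Adj) {l : List V} (hl : IsPermOf l K)
    (h : l.Pairwise fun a b => ¬ α.Adj b a) : l.Pairwise α.Adj := by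
  have hmem : ∀ x, x ∈ l ↔ x ∈ K := fun x => Set.ext_iff.1 hl.2 x
  refine (h.and hl.1).imp_of_mem ?_
  intro a b ha hb hab
  exact (hα.adj_or (hK ((hmem a).1 ha) ((hmem b).1 hb) hab.2)).resolve_right hab.1

theorem topological_list_unique {V : Type*} {Γ : SimpleGraph V} {α : Digraph V} (hα : IsAMO Γ α)
    {K : Set V} (hK : K.Pairwise Γ.Adj) {l l' : List V} (hl : IsPermOf l K) (hl' : IsPermOf l' K)
    (h : l.Pairwise fun a b => ¬ α.Adj b a) (h' : l'.Pairwise fun a b => ¬ α.Adj b a) : l = l' := by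
  refine List.Perm.eq_of_pairwise (le := α.Adj) ?_ (pairwise_adj_of_clique hα hK hl h)
    (pairwise_adj_of_clique hα hK hl' h') ?_
  · intro a b _ _ hab hba
    exact absurd hba (hα.not_adj_symm hab)
  · refine (List.perm_ext_iff_of_nodup hl.1 hl'.1).2 fun a => ?_
    exact (Set.ext_iff.1 hl.2 a).trans (Set.ext_iff.1 hl'.2 a).symm

/-- The initial segments of a topological ordering of an initial set are initial. -/
theorem isInitial_of_isPrefix {V : Type*} {α : Digraph V} {K : Set V} (hini : IsInitial α K)
    {l p : List V} (hl : IsPermOf l K) (h : l.Pairwise fun a b => ¬ α.Adj b a) (hp : p <+: l) :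
    IsInitial α {x | x ∈ p} := by
  obtain ⟨r, rfl⟩ := hp
  intro a b hab hb
  have hmem : ∀ x, x ∈ p ++ r ↔ x ∈ K := fun x => Set.ext_iff.1 hl.2 x
  have ha := (hmem a).2 (hini a b hab ((hmem b).1 (List.mem_append_left _ hb)))
  rcases List.mem_append.1 ha with ha | ha
  · exact ha
  · exact absurd hab ((List.pairwise_append.1 h).2.2 b hb a ha)

/-- On a clique the ordering is a chain for `α`. If its last element is in `S`, so is everything
before it; otherwise that element can be dropped. -/
theorem exists_prefix_of_isInitial {V : Type*} {Γ : SimpleGraph V} {α : Digraph V}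
    (hα : IsAMO Γ α) {K S : Set V} (hK : K.Pairwise Γ.Adj) (hSK : S ⊆ K) (hini : IsInitial α S)
    {l : List V} (hl : IsPermOf l K) (h : l.Pairwise fun a b => ¬ α.Adj b a) :
    ∃ p, p <+: l ∧ {x | x ∈ p} = S := by
  have hadj := pairwise_adj_of_clique hα hK hl h
  have hmem : ∀ x, x ∈ S → x ∈ l := fun x hx => (Set.ext_iff.1 hl.2 x).2 (hSK hx)
  clear hl h
  induction l using List.reverseRecOn with
  | nil => exact ⟨[], List.prefix_rfl, Set.ext fun x => ⟨fun h => by simp at h, hmem x⟩⟩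
  | append_singleton l a ih =>
    rw [List.pairwise_append] at hadj
    by_cases ha : a ∈ S
    · refine ⟨l ++ [a], List.prefix_rfl, Set.ext fun x => ⟨fun hx => ?_, hmem x⟩⟩
      rcases List.mem_append.1 hx with hx | hx
      · exact hini x a (hadj.2.2 x hx a (by simp)) ha
      · exact (List.mem_singleton.1 hx) ▸ ha
    · obtain ⟨p, hp, hpS⟩ := ih hadj.1 fun x hx =>
        (List.mem_append.1 (hmem x hx)).resolve_right fun h => ha (List.mem_singleton.1 h ▸ hx)
      exact ⟨p, hp.trans (List.prefix_append _ _), hpS⟩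

/-! ### Uniqueness of sources -/

/-- The last steps into a common descendant `y` come from vertices that are equal or, by morality,
adjacent. Either way one of them is an earlier common descendant. -/
theorem IsMoral.source_unique {V : Type*} [Finite V] {α : Digraph V} (hm : IsMoral α)
    (ha : IsAcyclic α) {s t : V} (hs : ∀ x, ¬ α.Adj x s) (ht : ∀ x, ¬ α.Adj x t) (y : V)
    (hsy : Relation.ReflTransGen α.Adj s y) (hty : Relation.ReflTransGen α.Adj t y) : s = t := by
  induction y using ha.wellFounded.induction with
  | _ y ih =>
  rcases Relation.ReflTransGen.cases_tail hsy with rfl | ⟨p, hsp, hpy⟩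
  · rcases Relation.ReflTransGen.cases_tail hty with rfl | ⟨p', -, hp'y⟩
    · rfl
    · exact absurd hp'y (hs _)
  · rcases Relation.ReflTransGen.cases_tail hty with rfl | ⟨p', htp', hp'y⟩
    · exact absurd hpy (ht _)
    · by_cases hpp : p = p'
      · exact ih p hpy hsp (hpp ▸ htp')
      · rcases hm p y p' hpp hpy hp'y with h | h
        · exact ih p' hp'y (hsp.tail h) htp'
        · exact ih p hpy hsp (htp'.tail h)

/-- The descendants of `s` are closed under adjacency in `Γ`: if `c → b` with `b` below `s`, then a
source above `c` is also above `b`, hence equals `s`. -/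
theorem IsMoral.source_unique_of_reachable {V : Type*} [Finite V] {α : Digraph V} (hm : IsMoral α)
    (ha : IsAcyclic α) {Γ : SimpleGraph V} (hΓ : ∀ a b, Γ.Adj a b → α.Adj a b ∨ α.Adj b a)
    {s t : V} (hs : ∀ x, ¬ α.Adj x s) (ht : ∀ x, ¬ α.Adj x t) (h : Γ.Reachable s t) : s = t := by
  have hsrc : ∀ y, ∃ r, (∀ x, ¬ α.Adj x r) ∧ Relation.ReflTransGen α.Adj r y := by
    intro y
    induction y using ha.wellFounded.induction with
    | _ y ih =>
    by_cases hy : ∃ x, α.Adj x y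
    · obtain ⟨x, hx⟩ := hy
      obtain ⟨r, hr, hrx⟩ := ih x hx
      exact ⟨r, hr, hrx.tail hx⟩
    · push Not at hy
      exact ⟨y, hy, .refl⟩
  suffices ∀ z, Γ.Reachable s z → Relation.ReflTransGen α.Adj s z from
    hm.source_unique ha hs ht t (this t h) .refl
  intro z hz
  rw [SimpleGraph.reachable_iff_reflTransGen] at hz
  induction hz with
  | refl => exact .refl
  | @tail b c _ hbc ih =>
    rcases hΓ b c hbc with h | h
    · exact ih.tail h
    · obtain ⟨r, hr, hrc⟩ := hsrc c
      exact hm.source_unique ha hs hr b ih (hrc.tail h) ▸ hrc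

/-! ### Forced orientations -/

/-- The orientations forced by the choice of the initial clique `K`: the edges leaving `K`, and
those that follow from `d → a - b` with `d`, `b` not adjacent. -/
inductive Forced {V : Type*} (Γ : SimpleGraph V) (K : Set V) : V → V → Prop
  | base {a b : V} : a ∈ K → b ∉ K → Γ.Adj a b → Forced Γ K a b
  | step {d a b : V} : Forced Γ K d a → Γ.Adj a b → d ≠ b → ¬ Γ.Adj d b → Forced Γ K a b

theorem Forced.graph_adj {V : Type*} {Γ : SimpleGraph V} {K : Set V} {a b : V}
    (h : Forced Γ K a b) : Γ.Adj a b := by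
  cases h with
  | base _ _ h => exact h
  | step _ h _ _ => exact h

/-- The reverse of a base edge would enter the initial set `K` from outside; the reverse of a step
edge would complete a v-structure at `a`. -/
theorem Forced.adj {V : Type*} {Γ : SimpleGraph V} {K : Set V} {α : Digraph V} (hα : IsAMO Γ α)
    (hK : IsInitial α K) {a b : V} (h : Forced Γ K a b) : α.Adj a b := by
  induction h with
  | base ha hb hab => exact (hα.adj_or hab).resolve_right fun h => hb (hK _ _ h ha)
  | step _ hab hdb hn ih =>
    exact (hα.adj_or hab).resolve_right fun h => hn (hα.adj_of_adj_of_adj hdb ih h)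

/-- The edges outside `K` which are not forced. -/
def freeGraph {V : Type*} (Γ : SimpleGraph V) (K : Set V) : SimpleGraph V where
  Adj a b := Γ.Adj a b ∧ a ∉ K ∧ b ∉ K ∧ ¬ Forced Γ K a b ∧ ¬ Forced Γ K b a
  symm := ⟨fun _ _ h => ⟨h.1.symm, h.2.2.1, h.2.1, h.2.2.2.2, h.2.2.2.1⟩⟩
  loopless := ⟨fun _ h => Γ.loopless.irrefl _ h.1⟩

/-- The AMO `α` supplies consistency of the forced directions and a well-founded order for the
induction on `a`. Nonadjacent `a`, `c` would force `b → c`. Otherwise suppose `a → c` is not forced;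
then `a ∉ K`, and `a → b` stems from some `d → a` with `d`, `b` nonadjacent. If `c → a` is forced,
it stems from some `e → c` with `e`, `a` nonadjacent; induction gives `e → b`, which forces `b → a`,
a contradiction. If `a - c` is free, induction gives `d → c`, which forces `c → b`, although `b - c`
is free. -/
theorem Forced.of_freeGraph_adj {V : Type*} [Finite V] {Γ : SimpleGraph V} {K : Set V}
    {α : Digraph V} (hα : IsAMO Γ α) (hK : IsInitial α K) {a b c : V} (h : Forced Γ K a b)
    (hbc : (freeGraph Γ K).Adj b c) : Forced Γ K a c := by
  induction a using hα.acyclic.wellFounded.transGen.induction generalizing b c with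
  | _ a ih =>
  obtain ⟨hbcΓ, hbK, hcK, hnbc, hncb⟩ := hbc
  have hac : Γ.Adj a c := by
    by_contra hn
    exact hnbc (h.step hbcΓ (by rintro rfl; exact hncb h) hn)
  by_cases hn : Forced Γ K a c
  · exact hn
  by_cases haK : a ∈ K
  · exact .base haK hcK hac
  exfalso
  obtain ⟨d, hda, hdb, hndb⟩ : ∃ d, Forced Γ K d a ∧ d ≠ b ∧ ¬ Γ.Adj d b := by
    cases h with
    | base h _ _ => exact absurd h haK
    | step h1 _ h2 h3 => exact ⟨_, h1, h2, h3⟩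
  by_cases hca : Forced Γ K c a
  · obtain ⟨e, hec, hea, hnea⟩ : ∃ e, Forced Γ K e c ∧ e ≠ a ∧ ¬ Γ.Adj e a := by
      cases hca with
      | base h _ _ => exact absurd h hcK
      | step h1 _ h2 h3 => exact ⟨_, h1, h2, h3⟩
    have heb : Forced Γ K e b := ih e (.tail (.single (hec.adj hα hK)) (hca.adj hα hK)) hec
      ⟨hbcΓ.symm, hcK, hbK, hncb, hnbc⟩
    have hba := heb.step h.graph_adj.symm hea hnea
    exact hα.not_adj_symm (hba.adj hα hK) (h.adj hα hK)
  · have hdc := ih d (.single (hda.adj hα hK)) hda ⟨hac, haK, hcK, hn, hca⟩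
    exact hncb (hdc.step hbcΓ.symm hdb hndb)

open Classical in
/-- The class of a vertex: `none` for the vertices of `K`, otherwise the component of the vertex in
the graph of the free edges. -/
noncomputable def freeClass {V : Type*} (Γ : SimpleGraph V) (K : Set V) (x : V) :
    Option (freeGraph Γ K).ConnectedComponent :=
  if x ∈ K then none else some ((freeGraph Γ K).connectedComponentMk x)

theorem freeClass_eq_iff {V : Type*} {Γ : SimpleGraph V} {K : Set V} {a b : V} (ha : a ∉ K) :
    freeClass Γ K a = freeClass Γ K b ↔ (freeGraph Γ K).Reachable a b := by
  have hK : (freeGraph Γ K).Reachable a b → b ∉ K := by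
    intro h
    rw [SimpleGraph.reachable_iff_reflTransGen] at h
    induction h with
    | refl => exact ha
    | tail _ h _ => exact h.2.2.1
  unfold freeClass
  by_cases hb : b ∈ K
  · simp only [ha, hb, if_true, if_false, reduceCtorEq, false_iff]
    exact fun h => hK h hb
  · simp only [ha, hb, if_false, Option.some.injEq, SimpleGraph.ConnectedComponent.eq]

theorem freeClass_mem_iff {V : Type*} {Γ : SimpleGraph V} {K : Set V} {a b : V}
    (h : freeClass Γ K a = freeClass Γ K b) : a ∈ K ↔ b ∈ K := by
  unfold freeClass at h
  by_cases ha : a ∈ K <;> by_cases hb : b ∈ K <;> simp_all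

theorem freeClass_eq_of_mem {V : Type*} {Γ : SimpleGraph V} {K : Set V} {a b : V} (ha : a ∈ K)
    (hb : b ∈ K) : freeClass Γ K a = freeClass Γ K b := by
  simp [freeClass, ha, hb]

theorem Forced.of_reachable {V : Type*} [Finite V] {Γ : SimpleGraph V} {K : Set V}
    {α : Digraph V} (hα : IsAMO Γ α) (hK : IsInitial α K) {a b c : V} (h : Forced Γ K a b)
    (hbc : (freeGraph Γ K).Reachable b c) : Forced Γ K a c := by
  rw [SimpleGraph.reachable_iff_reflTransGen] at hbc
  induction hbc with
  | refl => exact h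
  | tail _ hcd ih => exact ih.of_freeGraph_adj hα hK hcd

/-- Adjacent vertices in a component of the free graph are joined by a free edge. -/
theorem freeGraph_adj_of_reachable {V : Type*} [Finite V] {Γ : SimpleGraph V} {K : Set V}
    {α : Digraph V} (hα : IsAMO Γ α) (hK : IsInitial α K) {a b : V} (hab : Γ.Adj a b) (ha : a ∉ K)
    (h : (freeGraph Γ K).Reachable a b) : (freeGraph Γ K).Adj a b := by
  have hb : b ∉ K := fun hb => ha ((freeClass_mem_iff ((freeClass_eq_iff ha).2 h)).2 hb)
  have hirr : ∀ x, ¬ Forced Γ K x x := fun x hx => Γ.loopless.irrefl _ hx.graph_adj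
  exact ⟨hab, ha, hb, fun h' => hirr _ (h'.of_reachable hα hK h.symm),
    fun h' => hirr _ (h'.of_reachable hα hK h)⟩

/-- An unforced edge outside `K` is free and stays inside a class. With `Forced.adj`, all AMOs with
initial clique `K` therefore agree between classes. -/
theorem forced_of_adj_of_freeClass_ne {V : Type*} {Γ : SimpleGraph V} {K : Set V}
    {α : Digraph V} (hα : IsAMO Γ α) (hK : IsInitial α K) {a b : V} (hab : α.Adj a b)
    (hne : freeClass Γ K a ≠ freeClass Γ K b) : Forced Γ K a b := by
  have hb : b ∉ K := fun hb => hne (freeClass_eq_of_mem (hK a b hab hb) hb)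
  by_cases ha : a ∈ K
  · exact .base ha hb (hα.adj hab)
  · by_contra hn
    refine hne ((freeClass_eq_iff ha).2 (SimpleGraph.Adj.reachable ⟨hα.adj hab, ha, hb, hn, ?_⟩))
    exact fun h => hα.not_adj_symm hab (h.adj hα hK)

/-- Orientations with initial clique `K` may be changed arbitrarily inside `K` and inside the
components of the free graph. -/
theorem isAMO_glue_freeClass {V : Type*} [Finite V] {Γ : SimpleGraph V} {K : Set V}
    {α γ : Digraph V} (hα : IsAMO Γ α) (hK : IsInitial α K)
    (hγ : IsAMO (classGraph Γ (freeClass Γ K)) γ) :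
    IsAMO Γ (glue (freeClass Γ K) α γ) ∧ IsInitial (glue (freeClass Γ K) α γ) K := by
  refine ⟨isAMO_glue hα hγ fun a b b' hab hne hbb' => ?_, ?_⟩
  · have h := forced_of_adj_of_freeClass_ne hα hK hab hne
    have hb : b ∉ K := fun hb => hne (freeClass_eq_of_mem (hK a b hab hb) hb)
    exact (h.of_reachable hα hK ((freeClass_eq_iff hb).1 hbb'.symm)).adj hα hK
  · rintro a b (⟨h, -⟩ | ⟨-, h⟩) hb
    · exact (freeClass_mem_iff h).2 hb
    · exact hK a b h hb

/-- A clique of a chordal graph is the initial clique of an AMO, with any prescribed ordering. -/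
theorem IsChordal.exists_isAMO_initial {V : Type*} [Finite V] {G : SimpleGraph V}
    (hG : IsChordal G) {X K : Set V} (hKX : K ⊆ X) (hK : K.Pairwise G.Adj) {π : List V}
    (hπ : IsPermOf π K) : ∃ α, IsAMO (within G X) α ∧ IsInitial α K ∧
      π.Pairwise fun a b => ¬ α.Adj b a := by
  classical
  obtain ⟨f, hf, hfK, hfc⟩ := hG.exists_rank X K hKX hK
  have hmem : ∀ x, x ∈ π ↔ x ∈ K := fun x => Set.ext_iff.1 hπ.2 x
  -- Vertices of `K` are ranked by their position in `π`; all others are shifted past them.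
  set g : V → ℕ := fun x => if x ∈ K then π.idxOf x else π.length + f x with hg
  have hgK : ∀ x, x ∈ K → g x = π.idxOf x := fun x hx => by simp [hg, hx]
  have hgK' : ∀ x, x ∉ K → g x = π.length + f x := fun x hx => by simp [hg, hx]
  have hlt : ∀ x, x ∈ K → g x < π.length := fun x hx => by
    rw [hgK x hx]
    exact List.idxOf_lt_length_iff.2 ((hmem x).2 hx)
  have hlt' : ∀ a b, g a < g b → b ∈ K → a ∈ K := by
    intro a b hab hb
    by_contra ha
    have := hlt b hb
    rw [hgK' a ha] at hab
    omega
  refine ⟨orientByRank (within G X) g, isAMO_orientByRank ?_ ?_, ?_, ?_⟩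
  · rintro a b ⟨hab, ha, hb⟩ h
    by_cases haK : a ∈ K <;> by_cases hbK : b ∈ K
    · rw [hgK a haK, hgK b hbK] at h
      exact G.ne_of_adj hab ((List.idxOf_inj ((hmem a).2 haK)).1 h)
    · have := hlt a haK
      rw [hgK' b hbK] at h
      omega
    · have := hlt b hbK
      rw [hgK' a haK] at h
      omega
    · rw [hgK' a haK, hgK' b hbK] at h
      exact G.ne_of_adj hab (hf ha hb (by omega))
  · rintro a b c hac ⟨hab, ha, hb⟩ ⟨hcb, hc, -⟩ h1 h2
    refine ⟨?_, ha, hc⟩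
    by_cases hbK : b ∈ K
    · exact hK (hlt' a b h1 hbK) (hlt' c b h2 hbK) hac
    · have key : ∀ x ∈ X, g x < g b → f x < f b := by
        intro x hx h
        by_cases hxK : x ∈ K
        · exact hfK x hxK b hb hbK
        · rw [hgK' x hxK, hgK' b hbK] at h
          omega
      exact hfc a ha b hb c hc hac hab hcb (key a ha h1) (key c hc h2)
  · exact fun a b hab hb => hlt' a b hab.2 hb
  · rw [List.pairwise_iff_getElem]
    rintro i j hi hj hij ⟨-, h⟩
    rw [hgK _ ((hmem _).1 (List.getElem_mem hi)), hgK _ ((hmem _).1 (List.getElem_mem hj)),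
      hπ.1.idxOf_getElem, hπ.1.idxOf_getElem] at h
    omega

theorem IsChordal.exists_isAMO_isInitial {V : Type*} [Finite V] {G : SimpleGraph V}
    (hG : IsChordal G) {X K : Set V} (hKX : K ⊆ X) (hK : K.Pairwise G.Adj) :
    ∃ α, IsAMO (within G X) α ∧ IsInitial α K := by
  -- This first orientation only serves to list `K` in some order.
  obtain ⟨f, hf, hfK, hfc⟩ := hG.exists_rank X ∅ (Set.empty_subset _) (by simp)
  have hα : IsAMO (within G X) (orientByRank (within G X) f) := isAMO_orientByRank
    (fun a b hab h => G.ne_of_adj hab.1 (hf hab.2.1 hab.2.2 h))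
    fun a b c hac hab hcb h1 h2 => ⟨hfc a hab.2.1 b hab.2.2 c hcb.2.1 hac hab.1 hcb.1 h1 h2,
      hab.2.1, hcb.2.1⟩
  obtain ⟨π, hπ, -⟩ := exists_topological_list hα.acyclic K
  obtain ⟨α, hα, hαK, -⟩ := hG.exists_isAMO_initial hKX hK hπ
  exact ⟨α, hα, hαK⟩

/-- Both directions of a free edge occur in AMOs with initial clique `K`. -/
theorem IsChordal.exists_adj_of_freeGraph_adj {V : Type*} [Finite V] {G : SimpleGraph V}
    (hG : IsChordal G) {X K : Set V} (hKX : K ⊆ X) (hK : K.Pairwise G.Adj) {a b : V}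
    (hab : (freeGraph (within G X) K).Adj a b) :
    ∃ α, IsAMO (within G X) α ∧ IsInitial α K ∧ α.Adj a b := by
  classical
  set Γ := within G X with hΓ
  obtain ⟨α, hα, hαK⟩ := hG.exists_isAMO_isInitial hKX hK
  set q := freeClass Γ K with hq
  set C : Set V := {z | q a = q z} with hC
  have haK : a ∉ K := hab.2.1
  have hqab : q a = q b := (freeClass_eq_iff haK).2 hab.reachable
  have hCX : C ⊆ X := by
    intro z hz
    have h : (freeGraph Γ K).Reachable a z := (freeClass_eq_iff haK).1 hz
    exact mem_of_reachable_within hab.1.2.1 (h.mono (fun _ _ h => h.1 : freeGraph Γ K ≤ within G X))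
  -- Reorient the component `C` of `a` by a ranking that starts with `a`, which yields `a → b`, and
  -- keep `α` in the other classes.
  obtain ⟨f, hf, hfa, hfc⟩ := hG.exists_rank C {a} (by simp [hC]) (by simp)
  let γ : Digraph V := ⟨fun u v => Γ.Adj u v ∧ q u = q v ∧
    ((q a = q u ∧ f u < f v) ∨ (q a ≠ q u ∧ α.Adj u v))⟩
  have hγ : IsAMO (classGraph Γ q) γ := by
    refine IsAMO.of_graph ⟨fun u v => ⟨?_, ?_⟩, ?_⟩ (isAcyclic_of_exists_source fun Y hY => ?_) ?_
    · rintro ⟨huv, hquv⟩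
      by_cases h : q a = q u
      · have hne : f u ≠ f v := fun h' => G.ne_of_adj huv.1 (hf h (h.trans hquv) h')
        exact hne.lt_or_gt.imp (fun h' => ⟨huv, hquv, Or.inl ⟨h, h'⟩⟩)
          fun h' => ⟨huv.symm, hquv.symm, Or.inl ⟨h.trans hquv, h'⟩⟩
      · exact (hα.adj_or huv).imp (fun h' => ⟨huv, hquv, Or.inr ⟨h, h'⟩⟩)
          fun h' => ⟨huv.symm, hquv.symm, Or.inr ⟨hquv ▸ h, h'⟩⟩
    · rintro (h | h)
      · exact ⟨h.1, h.2.1⟩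
      · exact ⟨h.1.symm, h.2.1.symm⟩
    · rintro u v ⟨-, h, ⟨h1, h2⟩ | ⟨h1, h2⟩⟩ ⟨-, -, ⟨h3, h4⟩ | ⟨h3, h4⟩⟩
      · omega
      · exact h3 (h1.trans h)
      · exact h1 (h3.trans h.symm)
      · exact hα.not_adj_symm h2 h4
    · obtain ⟨y, hy⟩ := hY
      by_cases h : q a = q y
      · obtain ⟨z, ⟨hz, hzq⟩, hmin⟩ := (InvImage.wf f wellFounded_lt).has_min
          {z | z ∈ Y ∧ q a = q z} ⟨y, hy, h⟩
        refine ⟨z, hz, ?_⟩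
        rintro x hx ⟨-, hxz, ⟨h1, h2⟩ | ⟨h1, h2⟩⟩
        · exact hmin x ⟨hx, h1⟩ h2
        · exact h1 (hzq.trans hxz.symm)
      · obtain ⟨z, ⟨hz, hzq⟩, hmin⟩ := hα.acyclic.exists_source
          (Y := {z | z ∈ Y ∧ q z = q y}) ⟨y, hy, rfl⟩
        refine ⟨z, hz, ?_⟩
        rintro x hx ⟨-, hxz, ⟨h1, h2⟩ | ⟨h1, h2⟩⟩
        · exact h (h1.trans (hxz.trans hzq))
        · exact hmin x ⟨hx, hxz.trans hzq⟩ h2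
    · rintro u v w huw ⟨huv, hq1, ⟨h1, h2⟩ | ⟨h1, h2⟩⟩ ⟨hwv, hq2, ⟨h3, h4⟩ | ⟨h3, h4⟩⟩
      · exact ⟨⟨hfc u h1 v (h1.trans hq1) w h3 huw huv.1 hwv.1 h2 h4, huv.2.1, hwv.2.1⟩,
          hq1.trans hq2.symm⟩
      · exact absurd (h1.trans (hq1.trans hq2.symm)) h3
      · exact absurd (h3.trans (hq2.trans hq1.symm)) h1
      · exact ⟨hα.adj_of_adj_of_adj huw h2 h4, hq1.trans hq2.symm⟩
  obtain ⟨h1, h2⟩ := isAMO_glue_freeClass hα hαK hγ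
  refine ⟨_, h1, h2, Or.inl ⟨hqab, hab.1, hqab, Or.inl ⟨rfl, hfa a rfl b hqab ?_⟩⟩⟩
  exact fun h => G.ne_of_adj hab.1.1 h.symm

/-! ### The components of `H^K[V_H ∖ K]` -/

theorem exists_represents_iff {V : Type*} [Finite V] {G : SimpleGraph V} {H : G.Subgraph}
    {α : Digraph V} (hα : IsAMO H.spanningCoe α) {K : Set V} (hKH : K ⊆ H.verts) {π : List V}
    (hπ : IsPermOf π K) : (∃ τ, Represents H τ α ∧ π <+: τ) ↔
      IsInitial α K ∧ π.Pairwise fun a b => ¬ α.Adj b a := by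
  have hmem : ∀ x, x ∈ π ↔ x ∈ K := fun x => Set.ext_iff.1 hπ.2 x
  constructor
  · rintro ⟨τ, ⟨hτ, hpw⟩, σ, rfl⟩
    obtain ⟨h1, -, h2⟩ := List.pairwise_append.1 hpw
    refine ⟨fun a b hab hb => ?_, h1⟩
    have haH : a ∈ H.verts := H.edge_vert (hα.adj hab)
    have haτ : a ∈ π ++ σ := (Set.ext_iff.1 hτ.2 a).2 haH
    rcases List.mem_append.1 haτ with h | h
    · exact (hmem a).1 h
    · exact absurd hab (h2 b ((hmem b).2 hb) a h)
  · rintro ⟨hK, hpw⟩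
    obtain ⟨σ, hσ, hσpw⟩ := exists_topological_list hα.acyclic (H.verts \ K)
    have hmem' : ∀ x, x ∈ σ ↔ x ∈ H.verts \ K := fun x => Set.ext_iff.1 hσ.2 x
    refine ⟨π ++ σ, ⟨⟨?_, ?_⟩, ?_⟩, List.prefix_append _ _⟩
    · refine List.nodup_append'.2 ⟨hπ.1, hσ.1, fun x hx hx' => ?_⟩
      exact ((hmem' x).1 hx').2 ((hmem x).1 hx)
    · ext x
      change x ∈ π ++ σ ↔ x ∈ H.verts
      rw [List.mem_append, hmem, hmem']
      constructor
      · rintro (h | h)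
        · exact hKH h
        · exact h.1
      · intro h
        by_cases hx : x ∈ K
        · exact Or.inl hx
        · exact Or.inr ⟨h, hx⟩
    · refine List.pairwise_append.2 ⟨hpw, hσpw, fun a ha b hb hba => ?_⟩
      exact ((hmem' b).1 hb).2 (hK b a hba ((hmem a).1 ha))

theorem cliqueOrientation_adj_iff {V : Type*} [Finite V] {G : SimpleGraph V} {H : G.Subgraph}
    {K : Set V} (hKH : K ⊆ H.verts) {a b : V} : (cliqueOrientation H K).Adj a b ↔
      ∃ α, IsAMO H.spanningCoe α ∧ IsInitial α K ∧ α.Adj a b := by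
  constructor
  · rintro ⟨_, ⟨π, hπ, rfl⟩, α, ⟨hα, hτ⟩, hab⟩
    exact ⟨α, hα, ((exists_represents_iff hα hKH hπ).1 hτ).1, hab⟩
  · rintro ⟨α, hα, hK, hab⟩
    obtain ⟨π, hπ, hpw⟩ := exists_topological_list hα.acyclic K
    exact ⟨_, ⟨π, hπ, rfl⟩, α, ⟨hα, (exists_represents_iff hα hKH hπ).2 ⟨hK, hpw⟩⟩, hab⟩

/-- A forced edge has the same direction in every AMO with initial clique `K`, while a free edge
occurs in both. The union over AMOs is thereby replaced by the closure `Forced`. -/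
theorem undirectedPart_adj_iff {V : Type*} [Finite V] {G : SimpleGraph V} (hG : IsChordal G)
    {H : G.Subgraph} (hH : H.IsInduced) {K : Set V} (hKH : K ⊆ H.verts) (hK : K.Pairwise G.Adj)
    {a b : V} : (undirectedPart H K).Adj a b ↔ (freeGraph (within G H.verts) K).Adj a b := by
  have hco : ∀ a b, (cliqueOrientation H K).Adj a b ↔
      ∃ α, IsAMO (within G H.verts) α ∧ IsInitial α K ∧ α.Adj a b := by
    intro a b
    rw [← spanningCoe_eq_within hH]
    exact cliqueOrientation_adj_iff hKH
  constructor
  · rintro ⟨ha, hb, hab, hba⟩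
    obtain ⟨α, hα, hαK, hαab⟩ := (hco a b).1 hab
    obtain ⟨β, hβ, hβK, hβba⟩ := (hco b a).1 hba
    exact ⟨hα.adj hαab, ha.2, hb.2, fun h => hβ.not_adj_symm hβba (h.adj hβ hβK),
      fun h => hα.not_adj_symm hαab (h.adj hα hαK)⟩
  · intro hab
    exact ⟨⟨hab.1.2.1, hab.2.1⟩, ⟨hab.1.2.2, hab.2.2.1⟩,
      (hco a b).2 (hG.exists_adj_of_freeGraph_adj hKH hK hab),
      (hco b a).2 (hG.exists_adj_of_freeGraph_adj hKH hK hab.symm)⟩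

/-- The component of `v` in the free graph, as an induced subgraph. -/
def freeComponent {V : Type*} {G : SimpleGraph V} (H : G.Subgraph) (K : Set V) (v : V) :
    G.Subgraph :=
  (⊤ : G.Subgraph).induce {z | (freeGraph (within G H.verts) K).Reachable v z}

theorem reachable_freeGraph_mem {V : Type*} {G : SimpleGraph V} {X K : Set V} {v z : V}
    (hv : v ∈ X \ K) (h : (freeGraph (within G X) K).Reachable v z) : z ∈ X \ K := by
  rw [SimpleGraph.reachable_iff_reflTransGen] at h
  induction h with
  | refl => exact hv
  | tail _ h _ => exact ⟨h.1.2.2, h.2.2.1⟩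

theorem freeComponent_isInduced {V : Type*} {G : SimpleGraph V} (H : G.Subgraph) (K : Set V)
    (v : V) : (freeComponent H K v).IsInduced :=
  fun _ ha _ hb hab => ⟨ha, hb, hab⟩

theorem freeComponent_connected {V : Type*} [Finite V] {G : SimpleGraph V} {H : G.Subgraph}
    {K : Set V} {v : V} : (freeComponent H K v).Connected := by
  have hv : v ∈ (freeComponent H K v).verts := SimpleGraph.Reachable.refl (G := freeGraph _ K) v
  have key : ∀ z (hz : z ∈ (freeComponent H K v).verts),
      (freeComponent H K v).coe.Reachable ⟨v, hv⟩ ⟨z, hz⟩ := by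
    intro z hz
    have hz' := (SimpleGraph.reachable_iff_reflTransGen _ _).1 hz
    induction hz' with
    | refl => rfl
    | @tail b c hb hbc ih =>
      have hb' := (SimpleGraph.reachable_iff_reflTransGen _ _).2 hb
      refine (ih hb').trans (SimpleGraph.Adj.reachable ?_)
      exact ⟨hb', hz, hbc.1.1⟩
  rw [SimpleGraph.Subgraph.connected_iff, SimpleGraph.Subgraph.preconnected_iff]
  exact ⟨fun a b => (key a a.2).symm.trans (key b b.2), ⟨v, hv⟩⟩

/-- Adjacent vertices of a free component are joined by a free edge, so the maximal connected
subgraphs of the undirected part are induced subgraphs of `G`. -/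
theorem components_eq {V : Type*} [Finite V] {G : SimpleGraph V} (hG : IsChordal G)
    {H : G.Subgraph} (hH : H.IsInduced) {K : Set V} (hKH : K ⊆ H.verts) (hK : K.Pairwise G.Adj) :
    components H K = {C | ∃ v ∈ H.verts \ K, C = freeComponent H K v} := by
  obtain ⟨α, hα, hαK⟩ := hG.exists_isAMO_isInitial hKH hK
  have hle : ∀ v ∈ H.verts \ K, freeComponent H K v ≤ undirectedPart H K := by
    intro v hv
    refine ⟨fun z hz => reachable_freeGraph_mem hv hz, fun a b hab => ?_⟩
    obtain ⟨ha, hb, hab⟩ := hab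
    have ha' := reachable_freeGraph_mem hv ha
    have hb' := reachable_freeGraph_mem hv hb
    exact (undirectedPart_adj_iff hG hH hKH hK).2 (freeGraph_adj_of_reachable hα hαK
      ⟨hab, ha'.1, hb'.1⟩ ha'.2 (SimpleGraph.Reachable.trans (SimpleGraph.Reachable.symm ha) hb))
  have hge : ∀ C : G.Subgraph, C ≤ undirectedPart H K → C.Connected → ∀ v ∈ C.verts,
      C ≤ freeComponent H K v := by
    intro C hC hconn v hv
    have hreach : ∀ z ∈ C.verts, (freeGraph (within G H.verts) K).Reachable v z := by
      intro z hz
      have h := hconn.preconnected.coe ⟨v, hv⟩ ⟨z, hz⟩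
      exact h.map (⟨Subtype.val, fun {x y} h => (undirectedPart_adj_iff hG hH hKH hK).1
        (hC.2 h)⟩ : C.coe →g freeGraph (within G H.verts) K)
    exact ⟨hreach, fun a b hab => ⟨hreach a (C.edge_vert hab), hreach b (C.edge_vert hab.symm),
      hab.adj_sub⟩⟩
  ext C
  constructor
  · intro hC
    have hC' : Maximal (fun C' : G.Subgraph => C' ≤ undirectedPart H K ∧ C'.Connected) C := hC
    obtain ⟨v, hv⟩ := hC'.prop.2.nonempty
    have hv' : v ∈ H.verts \ K := hC'.prop.1.1 hv
    exact ⟨v, hv', hC'.eq_of_le ⟨hle v hv', freeComponent_connected⟩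
      (hge C hC'.prop.1 hC'.prop.2 v hv)⟩
  · rintro ⟨v, hv, rfl⟩
    refine ⟨⟨hle v hv, freeComponent_connected⟩, fun C' hC' hle' => hge C' hC'.1 hC'.2 v ?_⟩
    exact hle'.1 (SimpleGraph.Reachable.refl (G := freeGraph _ K) v)

/-- The AMOs whose restriction to the initial clique is given by `π`. -/
def amosWithPrefix {V : Type*} (Γ : SimpleGraph V) (K : Set V) (π : List V) : Set (Digraph V) :=
  {α | IsAMO Γ α ∧ IsInitial α K ∧ π.Pairwise fun a b => ¬ α.Adj b a}

/-- The maps are restrictions. Edges between classes are forced and edges inside `K` are fixed by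
`π`, so the restrictions determine the AMO; any family of AMOs of the components can be glued in. -/
theorem bijective_restrict_components {V : Type*} [Finite V] {G : SimpleGraph V}
    (hG : IsChordal G) {H : G.Subgraph} (hH : H.IsInduced) {K : Set V} (hKH : K ⊆ H.verts)
    (hK : K.Pairwise G.Adj) {π : List V} (hπ : IsPermOf π K) :
    ∃ F : amosWithPrefix (within G H.verts) K π → ∀ C : components H K,
      {γ : Digraph V | IsAMO C.1.spanningCoe γ}, Function.Bijective F := by
  have hcomp := components_eq hG hH hKH hK
  set Γ := within G H.verts with hΓ
  set q := freeClass Γ K with hq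
  have hmemC : ∀ C ∈ components H K, C.verts ⊆ H.verts \ K ∧ C.IsInduced ∧
      ∀ a ∈ C.verts, ∀ b, b ∈ C.verts ↔ q a = q b := by
    intro C hC
    rw [hcomp] at hC
    obtain ⟨v, hv, rfl⟩ := hC
    refine ⟨fun z hz => reachable_freeGraph_mem hv hz, freeComponent_isInduced _ _ _, ?_⟩
    intro a ha b
    have ha' := reachable_freeGraph_mem hv ha
    rw [freeClass_eq_iff ha'.2]
    exact ⟨fun hb => (SimpleGraph.Reachable.symm ha).trans hb, fun h =>
      SimpleGraph.Reachable.trans ha h⟩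
  have hexC : ∀ v ∈ H.verts \ K, ∃ C ∈ components H K, v ∈ C.verts := by
    intro v hv
    rw [hcomp]
    exact ⟨_, ⟨v, hv, rfl⟩, SimpleGraph.Reachable.refl (G := freeGraph _ K) v⟩
  have huniqC : ∀ C ∈ components H K, ∀ C' ∈ components H K, ∀ v, v ∈ C.verts → v ∈ C'.verts →
      C = C' := by
    intro C hC C' hC' v hv hv'
    have hverts : C.verts = C'.verts := by
      ext z
      rw [(hmemC C hC).2.2 v hv z, (hmemC C' hC').2.2 v hv' z]
    refine SimpleGraph.Subgraph.ext hverts ?_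
    ext a b
    exact ⟨fun h => (hmemC C' hC').2.1 (hverts ▸ C.edge_vert h) (hverts ▸ C.edge_vert h.symm)
      h.adj_sub, fun h => (hmemC C hC).2.1 (hverts ▸ C'.edge_vert h)
      (hverts ▸ C'.edge_vert h.symm) h.adj_sub⟩
  have hres : ∀ α, IsAMO Γ α → ∀ C : components H K,
      IsAMO C.1.spanningCoe (restrict α C.1.verts) := by
    intro α hα C
    rw [spanningCoe_eq_within (hmemC C.1 C.2).2.1]
    exact hα.restrict fun z hz => ((hmemC C.1 C.2).1 hz).1
  refine ⟨fun α C => ⟨restrict α.1 C.1.verts, hres α.1 α.2.1 C⟩, ?_, ?_⟩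
  · rintro ⟨α, hα, hαK, hαπ⟩ ⟨β, hβ, hβK, hβπ⟩ h
    have hrestrict : ∀ C ∈ components H K, restrict α C.verts = restrict β C.verts := fun C hC =>
      congrArg Subtype.val (congrFun h ⟨C, hC⟩)
    have key : ∀ α β : Digraph V, IsAMO Γ α → IsInitial α K →
        (π.Pairwise fun a b => ¬ α.Adj b a) → IsAMO Γ β → IsInitial β K →
        (π.Pairwise fun a b => ¬ β.Adj b a) →
        (∀ C ∈ components H K, restrict α C.verts = restrict β C.verts) →
        ∀ a b, α.Adj a b → β.Adj a b := by
      intro α β hα hαK hαπ hβ hβK hβπ hr a b hab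
      by_cases hne : q a = q b
      · have hadj := hα.adj hab
        by_cases haK : a ∈ K
        · have hbK : b ∈ K := (freeClass_mem_iff hne).1 haK
          have hKΓ : K.Pairwise Γ.Adj := fun x hx y hy hxy => ⟨hK hx hy hxy, hKH hx, hKH hy⟩
          refine (hβ.adj_or hadj).resolve_right fun hba => ?_
          have h1 := pairwise_adj_of_clique hα hKΓ hπ hαπ
          have h2 := pairwise_adj_of_clique hβ hKΓ hπ hβπ
          have h3 := h1.and h2
          have ha : a ∈ π := (Set.ext_iff.1 hπ.2 a).2 haK
          have hb : b ∈ π := (Set.ext_iff.1 hπ.2 b).2 hbK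
          rcases List.pairwise_iff_getElem.1 h3, List.getElem_of_mem ha, List.getElem_of_mem hb
            with ⟨h3, ⟨i, hi, rfl⟩, ⟨j, hj, rfl⟩⟩
          rcases lt_trichotomy i j with hij | rfl | hij
          · exact hβ.not_adj_symm hba (h3 i j hi hj hij).2
          · exact Γ.loopless.irrefl _ hadj
          · exact hα.not_adj_symm hab (h3 j i hj hi hij).1
        · obtain ⟨C, hC, haC⟩ := hexC a ⟨hadj.2.1, haK⟩
          have hbC := ((hmemC C hC).2.2 a haC b).2 hne
          have : (restrict α C.verts).Adj a b := ⟨hab, haC, hbC⟩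
          rw [hr C hC] at this
          exact this.1
      · exact (forced_of_adj_of_freeClass_ne hα hαK hab hne).adj hβ hβK
    refine Subtype.ext (Digraph.ext ?_)
    funext a b
    exact propext ⟨key α β hα hαK hαπ hβ hβK hβπ hrestrict a b,
      key β α hβ hβK hβπ hα hαK hαπ (fun C hC => (hrestrict C hC).symm) a b⟩
  · intro g
    obtain ⟨α, hα, hαK, hαπ⟩ := hG.exists_isAMO_initial hKH hK hπ
    have hg : ∀ C : components H K, IsAMO (within G C.1.verts) (g C).1 := fun C => by
      rw [← spanningCoe_eq_within (hmemC C.1 C.2).2.1]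
      exact (g C).2
    -- The given AMOs on the components, and `α` on `K`.
    let γ : Digraph V := ⟨fun u v => (∃ C, (g C).1.Adj u v) ∨ (u ∈ K ∧ v ∈ K ∧ α.Adj u v)⟩
    have hgK : ∀ C u v, (g C).1.Adj u v → u ∉ K ∧ v ∉ K ∧ q u = q v ∧ u ∈ C.1.verts ∧
        v ∈ C.1.verts := by
      intro C u v huv
      have h := (hg C).adj huv
      have hC := hmemC C.1 C.2
      exact ⟨(hC.1 h.2.1).2, (hC.1 h.2.2).2, (hC.2.2 u h.2.1 v).1 h.2.2, h.2⟩
    have hgadj : ∀ C u v, (g C).1.Adj u v → Γ.Adj u v := by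
      intro C u v huv
      have h := (hg C).adj huv
      have hC := hmemC C.1 C.2
      exact ⟨h.1, (hC.1 h.2.1).1, (hC.1 h.2.2).1⟩
    have huniq : ∀ C C' u v w, (g C).1.Adj u v → w = u ∨ w = v → w ∈ C'.1.verts → C = C' := by
      intro C C' u v w huv hw hw'
      obtain ⟨-, -, -, hu, hv⟩ := hgK C u v huv
      refine Subtype.ext (huniqC C.1 C.2 C'.1 C'.2 w ?_ hw')
      rcases hw with rfl | rfl <;> assumption
    have hγ : IsAMO (classGraph Γ q) γ := by
      refine IsAMO.of_graph ⟨fun u v => ⟨?_, ?_⟩, ?_⟩ (isAcyclic_of_exists_source fun Y hY => ?_) ?_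
      · rintro ⟨huv, hquv⟩
        by_cases huK : u ∈ K
        · have hvK : v ∈ K := (freeClass_mem_iff hquv).1 huK
          exact (hα.adj_or huv).imp (fun h => Or.inr ⟨huK, hvK, h⟩) fun h => Or.inr ⟨hvK, huK, h⟩
        · obtain ⟨C, hC, huC⟩ := hexC u ⟨huv.2.1, huK⟩
          have hvC := ((hmemC C hC).2.2 u huC v).2 hquv
          exact ((hg ⟨C, hC⟩).adj_or ⟨huv.1, huC, hvC⟩).imp (fun h => Or.inl ⟨_, h⟩)
            fun h => Or.inl ⟨_, h⟩
      · rintro ((⟨C, h⟩ | ⟨h1, h2, h⟩) | (⟨C, h⟩ | ⟨h1, h2, h⟩))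
        · exact ⟨hgadj C u v h, (hgK C u v h).2.2.1⟩
        · exact ⟨hα.adj h, freeClass_eq_of_mem h1 h2⟩
        · exact ⟨(hgadj C v u h).symm, (hgK C v u h).2.2.1.symm⟩
        · exact ⟨(hα.adj h).symm, freeClass_eq_of_mem h2 h1⟩
      · rintro u v (⟨C, h⟩ | ⟨h1, h2, h⟩) (⟨C', h'⟩ | ⟨h1', h2', h'⟩)
        · obtain rfl := huniq C C' u v v h (Or.inr rfl) (hgK C' v u h').2.2.2.1
          exact (hg C).not_adj_symm h h'
        · exact (hgK C u v h).1 h2'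
        · exact (hgK C' v u h').1 h2
        · exact hα.not_adj_symm h h'
      · by_cases hYK : ∃ y ∈ Y, y ∈ K
        · obtain ⟨y, hy, hyK⟩ := hYK
          obtain ⟨z, ⟨hz, hzK⟩, hmin⟩ := hα.acyclic.exists_source
            (Y := {z | z ∈ Y ∧ z ∈ K}) ⟨y, hy, hyK⟩
          refine ⟨z, hz, ?_⟩
          rintro x hx (⟨C, h⟩ | ⟨h1, h2, h⟩)
          · exact (hgK C x z h).2.1 hzK
          · exact hmin x ⟨hx, h1⟩ h
        · obtain ⟨y, hy⟩ := hY
          by_cases hyC : ∃ C : components H K, y ∈ C.1.verts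
          · obtain ⟨C, hyC⟩ := hyC
            obtain ⟨z, ⟨hz, hzC⟩, hmin⟩ := (hg C).acyclic.exists_source
              (Y := {z | z ∈ Y ∧ z ∈ C.1.verts}) ⟨y, hy, hyC⟩
            refine ⟨z, hz, ?_⟩
            rintro x hx (⟨C', h⟩ | ⟨h1, h2, h⟩)
            · obtain rfl := huniq C' C x z z h (Or.inr rfl) hzC
              exact hmin x ⟨hx, (hgK C' x z h).2.2.2.1⟩ h
            · exact hYK ⟨x, hx, h1⟩
          -- Here `y` lies outside `H`, where `γ` has no edges.
          · refine ⟨y, hy, ?_⟩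
            rintro x hx (⟨C', h⟩ | ⟨h1, h2, h⟩)
            · exact hyC ⟨C', (hgK C' x y h).2.2.2.2⟩
            · exact hYK ⟨x, hx, h1⟩
      · rintro u v w huw (⟨C, h⟩ | ⟨h1, h2, h⟩) (⟨C', h'⟩ | ⟨h1', h2', h'⟩)
        · obtain rfl := huniq C C' u v v h (Or.inr rfl) (hgK C' w v h').2.2.2.2
          have h3 := (hg C).adj_of_adj_of_adj huw h h'
          have hC := hmemC C.1 C.2
          exact ⟨⟨h3.1, (hC.1 h3.2.1).1, (hC.1 h3.2.2).1⟩, (hC.2.2 u h3.2.1 w).1 h3.2.2⟩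
        · exact absurd h2' (hgK C u v h).2.1
        · exact absurd h2 (hgK C' w v h').2.1
        · exact ⟨hα.adj_of_adj_of_adj huw h h', freeClass_eq_of_mem h1 h1'⟩
    obtain ⟨h1, h2⟩ := isAMO_glue_freeClass hα hαK hγ
    refine ⟨⟨glue q α γ, h1, h2, ?_⟩, ?_⟩
    · refine hαπ.imp_of_mem ?_
      intro a b ha hb hba
      have haK : a ∈ K := (Set.ext_iff.1 hπ.2 a).1 ha
      rintro (⟨-, ⟨C, h⟩ | ⟨-, -, h⟩⟩ | ⟨-, h⟩)
      · exact (hgK C b a h).2.1 haK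
      · exact hba h
      · exact hba h
    · funext C
      refine Subtype.ext (Digraph.ext ?_)
      funext a b
      refine propext ⟨?_, fun h => ?_⟩
      · rintro ⟨⟨-, ⟨C', h⟩ | ⟨h, -, -⟩⟩ | ⟨h, -⟩, ha, hb⟩
        · obtain rfl := huniq C' C a b a h (Or.inl rfl) ha
          exact h
        · exact absurd h ((hmemC C.1 C.2).1 ha).2
        · exact absurd (((hmemC C.1 C.2).2.2 a ha b).1 hb) h
      · obtain ⟨-, -, hqab, ha, hb⟩ := hgK C a b h
        exact ⟨Or.inl ⟨hqab, Or.inl ⟨C, h⟩⟩, ha, hb⟩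

theorem ncard_amosWithPrefix {V : Type*} [Finite V] {G : SimpleGraph V}
    (hG : IsChordal G) {H : G.Subgraph} (hH : H.IsInduced) {K : Set V} (hKH : K ⊆ H.verts)
    (hK : K.Pairwise G.Adj) {π : List V} (hπ : IsPermOf π K) {comps : List G.Subgraph}
    (hcomps : Enumerates comps (components H K)) :
    (amosWithPrefix (within G H.verts) K π).ncard =
      (comps.map fun C => numAMO C.spanningCoe).prod := by
  classical
  obtain ⟨F, hF⟩ := bijective_restrict_components hG hH hKH hK hπ
  have hfin : Fintype (components H K) := Fintype.ofFinset comps.toFinset fun C => by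
    simp [hcomps.2 C]
  rw [← Nat.card_coe_set_eq, Nat.card_congr (Equiv.ofBijective F hF), Nat.card_pi,
    ← List.prod_toFinset _ hcomps.1,
    Finset.prod_subtype (p := fun C => C ∈ components H K) comps.toFinset
      (fun C => by simp [hcomps.2 C])]
  exact Finset.prod_congr rfl fun C _ => Nat.card_coe_set_eq _

/-! ### Paths in trees -/

/-- The edges of the paths from `a` to `b`. -/
def pathEdges {N : Type*} (t : SimpleGraph N) (a b : N) : Set (Sym2 N) :=
  {e | ∃ p : t.Walk a b, p.IsPath ∧ e ∈ p.edges}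

/-- Shortening any walk to a path gives the unique path, so the walk uses all its edges. -/
theorem mem_edges_of_mem_pathEdges {N : Type*} {t : SimpleGraph N} (ht : t.IsTree) {a b : N}
    {e : Sym2 N} (he : e ∈ pathEdges t a b) (q : t.Walk a b) : e ∈ q.edges := by
  classical
  obtain ⟨p, hp, he⟩ := he
  have : p = q.bypass := (ht.existsUnique_path a b).unique hp q.bypass_isPath
  exact q.edges_bypass_subset_edges (this ▸ he)

theorem pathEdges_triangle {N : Type*} {t : SimpleGraph N} (ht : t.IsTree) {a b c : N} {e : Sym2 N}
    (he : e ∈ pathEdges t a c) : e ∈ pathEdges t a b ∨ e ∈ pathEdges t b c := by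
  obtain ⟨p, hp⟩ := (ht.existsUnique_path a b).exists
  obtain ⟨q, hq⟩ := (ht.existsUnique_path b c).exists
  have := mem_edges_of_mem_pathEdges ht he (p.append q)
  rw [SimpleGraph.Walk.edges_append, List.mem_append] at this
  exact this.imp (fun h => ⟨p, hp, h⟩) fun h => ⟨q, hq, h⟩

theorem pathEdges_symm {N : Type*} {t : SimpleGraph N} {a b : N} {e : Sym2 N}
    (he : e ∈ pathEdges t a b) : e ∈ pathEdges t b a := by
  obtain ⟨p, hp, he⟩ := he
  exact ⟨p.reverse, hp.reverse, by simpa using he⟩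

theorem mem_of_mem_pathEdges {N : Type*} {t : SimpleGraph N} (ht : t.IsTree) {S : Set N}
    (hS : (t.induce S).Connected) {a b : N} (ha : a ∈ S) (hb : b ∈ S) {e : Sym2 N}
    (he : e ∈ pathEdges t a b) {x : N} (hx : x ∈ e) : x ∈ S := by
  obtain ⟨p⟩ := hS.preconnected ⟨a, ha⟩ ⟨b, hb⟩
  let f : t.induce S →g t := (SimpleGraph.Embedding.induce S).toHom
  have h : e ∈ (p.map f).edges :=
    mem_edges_of_mem_pathEdges ht (a := f ⟨a, ha⟩) (b := f ⟨b, hb⟩) he _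
  rw [SimpleGraph.Walk.edges_map, List.mem_map] at h
  obtain ⟨e', -, rfl⟩ := h
  obtain ⟨y, -, rfl⟩ := Sym2.mem_map.1 hx
  exact y.2

/-- A walk can be cut at its first edge with a given property. -/
theorem exists_first_edge {N : Type*} {t : SimpleGraph N} {Q : Sym2 N → Prop} {a b : N}
    (p : t.Walk a b) (h : ∃ e ∈ p.edges, Q e) :
    ∃ x y, t.Adj x y ∧ Q s(x, y) ∧ ∃ q : t.Walk a x, ∀ e ∈ q.edges, ¬ Q e := by
  induction p with
  | nil => simp at h
  | @cons a c b hac p ih =>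
    by_cases hQ : Q s(a, c)
    · exact ⟨a, c, hac, hQ, .nil, by simp⟩
    · obtain ⟨x, y, hxy, hQxy, q, hq⟩ := ih (by
        obtain ⟨e, he, hQe⟩ := h
        rw [SimpleGraph.Walk.edges_cons, List.mem_cons] at he
        rcases he with rfl | he
        · exact absurd hQe hQ
        · exact ⟨e, he, hQe⟩)
      refine ⟨x, y, hxy, hQxy, .cons hac q, fun e he => ?_⟩
      rw [SimpleGraph.Walk.edges_cons, List.mem_cons] at he
      rcases he with rfl | he
      · exact hQ
      · exact hq e he

/-! ### Separators in clique trees -/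

namespace RootedCliqueTree

variable {V : Type*} {G : SimpleGraph V} {H : G.Subgraph} (T : RootedCliqueTree H)

/-- The intersection of the cliques at the ends of an edge. -/
def sep (e : Sym2 T.Node) : Set V := {v | ∀ x ∈ e, v ∈ T.ι x}

theorem sep_mk (x y : T.Node) : T.sep s(x, y) = T.ι x ∩ T.ι y := by
  ext v
  simp [sep]

theorem mem_FP_iff {v : T.Node} {S : Set V} :
    S ∈ T.FP v ↔ S ⊆ T.ι v ∧ ∃ e ∈ pathEdges T.tree T.root v, S = T.sep e := by
  constructor
  · rintro ⟨p, hp, d, hd, rfl, hS⟩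
    exact ⟨hS, d.edge, ⟨p, hp, List.mem_map_of_mem hd⟩, (T.sep_mk _ _).symm⟩
  · rintro ⟨hS, e, ⟨p, hp, he⟩, rfl⟩
    obtain ⟨d, hd, rfl⟩ := List.mem_map.1 he
    exact ⟨p, hp, d, hd, T.sep_mk _ _, hS⟩

theorem isMaxCliqueWithin (hH : H.IsInduced) (x : T.Node) :
    IsMaxCliqueWithin G H.verts (T.ι x) := by
  have h := T.bijOn.mapsTo (Set.mem_univ x)
  rwa [maxCliques_eq hH] at h

theorem exists_node (hH : H.IsInduced) {K : Set V} (hK : IsMaxCliqueWithin G H.verts K) :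
    ∃ x, T.ι x = K := by
  have h : K ∈ maxCliques H := by rwa [maxCliques_eq hH]
  obtain ⟨x, -, hx⟩ := T.bijOn.surjOn h
  exact ⟨x, hx⟩

theorem eq_of_subset (hH : H.IsInduced) {x y : T.Node} (h : T.ι x ⊆ T.ι y) : x = y :=
  T.bijOn.injOn (Set.mem_univ x) (Set.mem_univ y)
    ((T.isMaxCliqueWithin hH x).eq_of_le (T.isMaxCliqueWithin hH y).prop h)

theorem mem_sep (hH : H.IsInduced) {a b : T.Node} {u : V} (ha : u ∈ T.ι a) (hb : u ∈ T.ι b)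
    {e : Sym2 T.Node} (he : e ∈ pathEdges T.tree a b) : u ∈ T.sep e :=
  fun _ hx => mem_of_mem_pathEdges T.isTree
    (T.connected u ((T.isMaxCliqueWithin hH a).prop.1 ha)) ha hb he hx

/-- Consecutive cliques on the walk share a vertex outside `S`, through which one can pass. -/
theorem reachable_of_walk (hH : H.IsInduced) (S : Set V) {a b : T.Node} (p : T.tree.Walk a b)
    (hp : ∀ e ∈ p.edges, ∃ u ∈ T.sep e, u ∉ S) {x y : V} (hx : x ∈ T.ι a) (hxS : x ∉ S)
    (hy : y ∈ T.ι b) (hyS : y ∉ S) : (within G (H.verts \ S)).Reachable x y := by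
  have hclique : ∀ a : T.Node, ∀ x ∈ T.ι a, ∀ y ∈ T.ι a, x ∉ S → y ∉ S →
      (within G (H.verts \ S)).Reachable x y := by
    intro a x hx y hy hxS hyS
    have h := (T.isMaxCliqueWithin hH a).prop
    by_cases hxy : x = y
    · rw [hxy]
    · exact SimpleGraph.Adj.reachable ⟨h.2 hx hy hxy, ⟨h.1 hx, hxS⟩, h.1 hy, hyS⟩
  induction p generalizing x with
  | nil => exact hclique _ x hx y hy hxS hyS
  | @cons a c b hac p ih =>
    rw [SimpleGraph.Walk.edges_cons] at hp
    obtain ⟨u, hu, huS⟩ := hp s(a, c) (by simp)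
    rw [sep_mk] at hu
    exact (hclique a x hx u hu.1 hxS huS).trans
      (ih (fun e he => hp e (List.mem_cons_of_mem _ he)) hu.2 huS hy)

/-- If two maximal cliques are initial in the same AMO, then their intersection is a separator on
the path between them. -/
theorem exists_sep_eq_inter [Finite V] (hH : H.IsInduced) {α : Digraph V}
    (hα : IsAMO (within G H.verts) α) {v w : T.Node} (hvw : v ≠ w) (hv : IsInitial α (T.ι v))
    (hw : IsInitial α (T.ι w)) :
    ∃ e ∈ pathEdges T.tree v w, T.sep e = T.ι v ∩ T.ι w := by
  by_contra hcon
  push Not at hcon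
  set S := T.ι v ∩ T.ι w with hS
  obtain ⟨p, hp⟩ := (T.isTree.existsUnique_path v w).exists
  have hsep : ∀ e ∈ p.edges, ∃ u ∈ T.sep e, u ∉ S := by
    intro e he
    have he' : e ∈ pathEdges T.tree v w := ⟨p, hp, he⟩
    by_contra hn
    push Not at hn
    exact hcon e he' (Set.Subset.antisymm hn fun u hu => T.mem_sep hH hu.1 hu.2 he')
  -- The first vertex of `ι v` outside `ι w` has all its parents in the intersection, so it becomes
  -- a source once the intersection is deleted.
  have hsource : ∀ v w : T.Node, v ≠ w → IsInitial α (T.ι v) →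
      ∃ a ∈ T.ι v, a ∉ T.ι w ∧ ∀ x, α.Adj x a → x ∈ T.ι v ∧ x ∈ T.ι w := by
    intro v w hvw hv
    obtain ⟨a, ⟨ha, haw⟩, hmin⟩ := hα.acyclic.exists_source (Y := T.ι v \ T.ι w) (by
      by_contra h
      rw [Set.not_nonempty_iff_eq_empty, Set.sdiff_eq_empty] at h
      exact hvw (T.eq_of_subset hH h))
    refine ⟨a, ha, haw, fun x hx => ⟨hv x a hx ha, ?_⟩⟩
    by_contra hxw
    exact hmin x ⟨hv x a hx ha, hxw⟩ hx
  obtain ⟨a, hav, haw, hasrc⟩ := hsource v w hvw hv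
  obtain ⟨b, hbw, hbv, hbsrc⟩ := hsource w v hvw.symm hw
  have hr := T.reachable_of_walk hH S p hsep hav (fun h => haw h.2) hbw (fun h => hbv h.1)
  have hmoral : IsMoral (restrict α Sᶜ) := fun x y z hxz hxy hzy =>
    (hα.moral x y z hxz hxy.1 hzy.1).imp (fun h => ⟨h, hxy.2.1, hzy.2.1⟩)
      fun h => ⟨h, hzy.2.1, hxy.2.1⟩
  have hacyc : IsAcyclic (restrict α Sᶜ) := hα.acyclic.mono fun _ _ h => h.1
  have hab : a = b := hmoral.source_unique_of_reachable hacyc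
    (Γ := within G (H.verts \ S))
    (fun x y hxy => (hα.adj_or ⟨hxy.1, hxy.2.1.1, hxy.2.2.1⟩).imp
      (fun h => ⟨h, hxy.2.1.2, hxy.2.2.2⟩) fun h => ⟨h, hxy.2.2.2, hxy.2.1.2⟩)
    (fun x hx => hx.2.1 (hasrc x hx.1)) (fun x hx => hx.2.1 (hbsrc x hx.1).symm) hr
  exact haw (hab ▸ hbw)

/-- The maximal clique at `v` is initial in `α`, and no initial set is a forbidden prefix. -/
def IsStart (α : Digraph V) (v : T.Node) : Prop :=
  IsInitial α (T.ι v) ∧ ∀ S ∈ T.FP v, ¬ IsInitial α S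

theorem isStart_unique [Finite V] (hH : H.IsInduced) {α : Digraph V}
    (hα : IsAMO (within G H.verts) α) {v w : T.Node} (hv : T.IsStart α v) (hw : T.IsStart α w) :
    v = w := by
  by_contra hvw
  obtain ⟨e, he, hsep⟩ := T.exists_sep_eq_inter hH hα hvw hv.1 hw.1
  have hini : IsInitial α (T.sep e) := by
    rw [hsep]
    exact fun a b hab hb => ⟨hv.1 a b hab hb.1, hw.1 a b hab hb.2⟩
  rcases pathEdges_triangle (b := T.root) T.isTree he with h | h
  · exact hv.2 _ (T.mem_FP_iff.2 ⟨hsep ▸ Set.inter_subset_left, e, pathEdges_symm h, rfl⟩) hini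
  · exact hw.2 _ (T.mem_FP_iff.2 ⟨hsep ▸ Set.inter_subset_right, e, h, rfl⟩) hini

end RootedCliqueTree

/-- An initial clique can be extended to an initial maximal clique inside a region `Y` which
contains the common neighbours of `P` that are adjacent to a vertex of `Y ∖ P`. -/
theorem exists_isInitial_isMaxCliqueWithin {V : Type*} [Finite V] {G : SimpleGraph V} {X : Set V}
    {α : Digraph V} (hα : IsAMO (within G X) α) {P Y : Set V} (hPY : P ⊆ Y) (hYX : Y ⊆ X)
    (hP : P.Pairwise G.Adj) (hPini : IsInitial α P)
    (hne : ∃ z ∈ Y, z ∉ P ∧ ∀ c ∈ P, G.Adj c z)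
    (hY : ∀ z ∈ Y, z ∉ P → ∀ p ∈ X, G.Adj z p → (∀ c ∈ P, G.Adj c p) → p ∈ Y) :
    ∃ Q, IsMaxCliqueWithin G X Q ∧ IsInitial α Q ∧ P ⊂ Q ∧ Q ⊆ Y := by
  obtain ⟨Q, hPQ, hQ⟩ := Finite.exists_le_maximal
    (p := fun Q : Set V => P ⊆ Q ∧ Q ⊆ Y ∧ Q.Pairwise G.Adj ∧ IsInitial α Q)
    (a := P) ⟨subset_rfl, hPY, hP, hPini⟩
  obtain ⟨⟨-, hQY, hQc, hQini⟩, hQmax⟩ := hQ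
  -- An `α`-first common neighbour `z` of `Q` in `Y` could be added to `Q`: a parent of `z` outside
  -- `Q` would, by morality, be adjacent to all of `Q`, hence lie in `Y` and be an earlier
  -- candidate.
  have hnone : ∀ z ∈ Y, z ∉ Q → ¬ ∀ c ∈ Q, G.Adj c z := by
    intro z₀ hz₀ hz₀Q hadj₀
    obtain ⟨z, ⟨hzY, hzQ, hadj⟩, hmin⟩ := hα.acyclic.exists_source
      (Y := {z | z ∈ Y ∧ z ∉ Q ∧ ∀ c ∈ Q, G.Adj c z}) ⟨z₀, hz₀, hz₀Q, hadj₀⟩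
    refine hzQ (hQmax (y := insert z Q) ⟨hPQ.trans (Set.subset_insert _ _),
      Set.insert_subset hzY hQY, ?_, ?_⟩ (Set.subset_insert _ _) (Set.mem_insert _ _))
    · rintro a (rfl | ha) b (rfl | hb) hab
      · exact absurd rfl hab
      · exact (hadj b hb).symm
      · exact hadj a ha
      · exact hQc ha hb hab
    · rintro a b hab (rfl | hb)
      · by_contra haQ
        have haQ' : a ∉ Q := fun h => haQ (Or.inr h)
        have hG := hα.adj hab
        have hac : ∀ c ∈ Q, G.Adj c a := by
          intro c hc
          have hcz : α.Adj c b := (hα.adj_or ⟨hadj c hc, hYX (hQY hc), hYX hzY⟩).resolve_right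
            fun h => hzQ (hQini b c h hc)
          exact (hα.adj_of_adj_of_adj (fun h : c = a => haQ' (h ▸ hc)) hcz hab).1
        exact hmin a ⟨hY b hzY (fun h => hzQ (hPQ h)) a hG.2.1 hG.1.symm
          fun c hc => hac c (hPQ hc), haQ', hac⟩ hab
      · exact Or.inr (hQini a b hab hb)
  have hPQ' : P ⊂ Q := by
    refine hPQ.ssubset_of_ne ?_
    rintro rfl
    obtain ⟨z, hz, hzP, hadj⟩ := hne
    exact hnone z hz hzP hadj
  -- `Q` is maximal in all of `X`: a common neighbour of `Q` is adjacent to some `z ∈ Q \ P`, so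
  -- `hY` puts it in `Y`.
  refine ⟨Q, ⟨⟨hQY.trans hYX, hQc⟩, fun K hK hQK w hw => ?_⟩, hQini, hPQ', hQY⟩
  by_contra hwQ
  obtain ⟨z, hzQ, hzP⟩ := Set.exists_of_ssubset hPQ'
  have hadj : ∀ c ∈ Q, G.Adj c w := fun c hc => hK.2 (hQK hc) hw fun h => hwQ (h ▸ hc)
  exact hnone w (hY z (hQY hzQ) hzP w (hK.1 hw) (hadj z hzQ) fun c hc => hadj c (hPQ hc)) hwQ hadj

namespace RootedCliqueTree

variable {V : Type*} {G : SimpleGraph V} {H : G.Subgraph} (T : RootedCliqueTree H)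

/-- From an initial clique with an initial forbidden prefix `P` one gets to another one whose
initial forbidden prefixes are larger than `P`. -/
theorem exists_isInitial_of_forbidden [Finite V] (hH : H.IsInduced) {α : Digraph V}
    (hα : IsAMO (within G H.verts) α) {v : T.Node} {P : Set V} (hP : P ∈ T.FP v)
    (hPini : IsInitial α P)
    (hmin : ∀ S ∈ T.FP v, IsInitial α S → P.ncard ≤ S.ncard) :
    ∃ w, IsInitial α (T.ι w) ∧ ∀ S ∈ T.FP w, IsInitial α S → P.ncard < S.ncard := by
  obtain ⟨hPv, e, ⟨p, -, he⟩, hPe⟩ := T.mem_FP_iff.1 hP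
  have hmax := T.isMaxCliqueWithin hH
  have hPc : P.Pairwise G.Adj := (hmax v).prop.2.mono hPv
  -- The nodes containing `P` whose root path crosses no separator equal to `P`.
  set D : Set T.Node := {u | P ⊆ T.ι u ∧ ∀ e ∈ pathEdges T.tree T.root u, T.sep e ≠ P} with hD
  have hDmem : ∀ u ∈ D, ∀ u', P ⊆ T.ι u' → ∀ z ∈ T.ι u, z ∈ T.ι u' → z ∉ P → u' ∈ D := by
    intro u hu u' hPu' z hzu hzu' hzP
    refine ⟨hPu', fun e he hsep => ?_⟩
    rcases pathEdges_triangle (b := u) T.isTree he with h | h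
    · exact hu.2 e h hsep
    · exact hzP (hsep ▸ T.mem_sep hH hzu hzu' h)
  -- The near end `x` of the first edge with separator `P` on the way to `v` shows that `D` is
  -- nonempty; `ι x ⊄ ι y` leaves room to enlarge `P`.
  obtain ⟨x, y, hxy, hQ, q, hq⟩ := exists_first_edge (Q := fun e => T.sep e = P) p ⟨e, he, hPe.symm⟩
  rw [T.sep_mk] at hQ
  have hxD : x ∈ D := ⟨hQ ▸ Set.inter_subset_left, fun e he =>
    hq e (mem_edges_of_mem_pathEdges T.isTree he q)⟩
  set Y : Set V := {z | ∃ u ∈ D, z ∈ T.ι u} with hY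
  obtain ⟨Q, hQmax, hQini, hPQ, hQY⟩ := exists_isInitial_isMaxCliqueWithin (Y := Y) hα
    (fun c hc => ⟨x, hxD, hxD.1 hc⟩) (by
      rintro z ⟨u, -, hz⟩
      exact (hmax u).prop.1 hz) hPc hPini
    (by
      obtain ⟨z, hzx, hzy⟩ : ∃ z ∈ T.ι x, z ∉ T.ι y := by
        by_contra h
        push Not at h
        exact T.tree.ne_of_adj hxy (T.eq_of_subset hH h)
      have hzP : z ∉ P := fun h => hzy (hQ ▸ h : z ∈ T.ι x ∩ T.ι y).2
      exact ⟨z, ⟨x, hxD, hzx⟩, hzP, fun c hc => (hmax x).prop.2 (hxD.1 hc) hzx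
        fun h => hzP (h ▸ hc)⟩)
    (by
      rintro z ⟨u, hu, hzu⟩ hzP p hp hzp hcp
      have hcl : (insert p (insert z P)).Pairwise G.Adj := by
        have hPz : ∀ c ∈ P, G.Adj c z := fun c hc =>
          (hmax u).prop.2 (hu.1 hc) hzu fun h => hzP (h ▸ hc)
        rintro a (rfl | rfl | ha) b (rfl | rfl | hb) hab
        · exact absurd rfl hab
        · exact hzp.symm
        · exact (hcp b hb).symm
        · exact hzp
        · exact absurd rfl hab
        · exact (hPz b hb).symm
        · exact hcp a ha
        · exact hPz a ha
        · exact hPc ha hb hab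
      obtain ⟨K, hK, hle⟩ := exists_isMaxCliqueWithin_ge (Set.insert_subset hp (Set.insert_subset
        ((hmax u).prop.1 hzu) (hu.1.trans (hmax u).prop.1))) hcl
      obtain ⟨u', rfl⟩ := T.exists_node hH hK
      exact ⟨u', hDmem u hu u' (fun c hc => hle (by simp [hc])) z hzu (hle (by simp)) hzP,
        hle (by simp)⟩)
  obtain ⟨w, rfl⟩ := T.exists_node hH hQmax
  have hwD : w ∈ D := by
    obtain ⟨z, hzw, hzP⟩ := Set.exists_of_ssubset hPQ
    obtain ⟨u, hu, hzu⟩ := hQY hzw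
    exact hDmem u hu w hPQ.subset z hzu hzw hzP
  refine ⟨w, hQini, fun S hS hSini => ?_⟩
  by_contra hlt
  obtain ⟨hSw, e', he', hSe'⟩ := T.mem_FP_iff.1 hS
  have hne : S ≠ P := hSe' ▸ hwD.2 e' he'
  -- Two initial subsets of a clique are comparable, and `S` is not larger than `P`.
  have hSP : S ⊆ P := by
    by_contra hSP
    obtain ⟨a, haS, haP⟩ := Set.not_subset.1 hSP
    refine hne (Set.eq_of_subset_of_ncard_le (fun b hb => ?_) (not_lt.1 hlt) (Set.toFinite _)).symm
    by_contra hbS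
    have haw := hSw haS
    have hbw := hPQ.subset hb
    rcases hα.adj_or ⟨(hmax w).prop.2 haw hbw fun h => haP (h ▸ hb), (hmax w).prop.1 haw,
      (hmax w).prop.1 hbw⟩ with h | h
    · exact haP (hPini a b h hb)
    · exact hbS (hSini b a h haS)
  -- If the edge of `S` is on the root path of `v`, then `S` is a forbidden prefix of `v` and
  -- minimality of `P` gives `S = P`. If it is between `v` and `w`, both of whose cliques contain
  -- `P`, then `P ⊆ S`. But `w ∈ D` excludes `S = P`.
  rcases pathEdges_triangle (b := v) T.isTree he' with h | h
  · exact hne (Set.eq_of_subset_of_ncard_le hSP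
      (hmin S (T.mem_FP_iff.2 ⟨hSP.trans hPv, e', h, hSe'⟩) hSini) (Set.toFinite _))
  · exact hne (Set.Subset.antisymm hSP fun c hc =>
      hSe' ▸ T.mem_sep hH (hPv hc) (hPQ.subset hc) h)

theorem exists_isStart [Finite V] (hH : H.IsInduced) (hne : H.verts.Nonempty) {α : Digraph V}
    (hα : IsAMO (within G H.verts) α) : ∃ v, T.IsStart α v := by
  have key : ∀ k : ℕ, ∃ v, IsInitial α (T.ι v) ∧
      ∀ S ∈ T.FP v, IsInitial α S → k ≤ S.ncard := by
    intro k
    induction k with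
    | zero =>
      obtain ⟨Q, hQ, hQini, -, -⟩ := exists_isInitial_isMaxCliqueWithin (Y := H.verts) hα
        (Set.empty_subset _) subset_rfl (by simp) (fun _ _ _ h => h.elim)
        (by
          obtain ⟨z, hz⟩ := hne
          exact ⟨z, hz, id, fun c hc => hc.elim⟩) fun z _ _ p hp _ _ => hp
      obtain ⟨v, rfl⟩ := T.exists_node hH hQ
      exact ⟨v, hQini, fun _ _ _ => Nat.zero_le _⟩
    | succ k ih =>
      obtain ⟨v, hv, hvmin⟩ := ih
      by_cases h : ∃ P ∈ T.FP v, IsInitial α P ∧ P.ncard = k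
      · obtain ⟨P, hP, hPini, rfl⟩ := h
        exact T.exists_isInitial_of_forbidden hH hα hP hPini hvmin
      · push Not at h
        exact ⟨v, hv, fun S hS hSini => (hvmin S hS hSini).lt_of_ne (h S hS hSini).symm⟩
  -- No set has more than `Nat.card V` elements, so at this bound no initial forbidden prefix is
  -- left.
  obtain ⟨v, hv, hmin⟩ := key (Nat.card V + 1)
  refine ⟨v, hv, fun S hS hSini => ?_⟩
  have := hmin S hS hSini
  have := Set.ncard_le_card S
  omega

end RootedCliqueTree

/-! ### The counting formula -/

/-- The product of the numbers of AMOs of the components in `𝒞_H(K)`. -/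
noncomputable def componentProduct {V : Type*} {G : SimpleGraph V} (H : G.Subgraph) (K : Set V) :
    ℕ :=
  ∏ᶠ C ∈ components H K, numAMO C.spanningCoe

theorem componentProduct_eq {V : Type*} {G : SimpleGraph V} {H : G.Subgraph} {K : Set V}
    {comps : List G.Subgraph} (hcomps : Enumerates comps (components H K)) :
    (comps.map fun C => numAMO C.spanningCoe).prod = componentProduct H K := by
  classical
  have hset : components H K = ↑comps.toFinset := by
    ext C
    simp [hcomps.2 C]
  rw [componentProduct, hset, finprod_mem_coe_finset, List.prod_toFinset _ hcomps.1]

theorem exists_enumerates {A : Type*} [Finite A] (s : Set A) : ∃ l : List A, Enumerates l s := by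
  classical
  exact ⟨(Set.toFinite s).toFinset.toList, Finset.nodup_toList _, by simp⟩

instance RootedCliqueTree.finite_node {V : Type*} [Finite V] {G : SimpleGraph V} {H : G.Subgraph}
    (T : RootedCliqueTree H) : Finite T.Node :=
  Finite.of_injective T.ι (Set.injOn_univ.1 T.bijOn.injOn)

theorem finite_isPermOf {V : Type*} [Finite V] (S : Set V) :
    {l : List V | IsPermOf l S}.Finite := by
  have := Fintype.ofFinite V
  refine (List.finite_length_le V (Fintype.card V)).subset fun l hl => ?_
  exact hl.1.length_le_card

/-- AMOs correspond to triples of the start node `v`, the order `π` that the AMO induces on `ι v`,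
and an AMO with initial segment `π`. The number of choices for the last entry does not depend on
`π`. -/
theorem numAMO_eq_sum {V : Type*} [Finite V] {G : SimpleGraph V} (hG : IsChordal G)
    {H : G.Subgraph} (hH : H.IsInduced) (hne : H.verts.Nonempty) (T : RootedCliqueTree H)
    [Fintype T.Node] : numAMO H.spanningCoe =
      ∑ v : T.Node, phi (T.ι v) (T.FP v) * componentProduct H (T.ι v) := by
  have : Finite (Digraph V) := Finite.of_injective Digraph.Adj fun _ _ h => Digraph.ext h
  have hmax := T.isMaxCliqueWithin hH
  have hΓ : ∀ v, (T.ι v).Pairwise (within G H.verts).Adj := fun v a ha b hb hab =>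
    ⟨(hmax v).prop.2 ha hb hab, (hmax v).prop.1 ha, (hmax v).prop.1 hb⟩
  let L : T.Node → Set (List V) := fun v =>
    {l | IsPermOf l (T.ι v) ∧ ∀ p, p <+: l → {x | x ∈ p} ∉ T.FP v}
  have hL : ∀ v, Finite (L v) := fun v => ((finite_isPermOf (T.ι v)).subset fun l hl => hl.1)
  let F : (Σ v : T.Node, Σ π : L v, amosWithPrefix (within G H.verts) (T.ι v) π.1) →
      {α : Digraph V | IsAMO (within G H.verts) α} := fun x => ⟨x.2.2.1, x.2.2.2.1⟩
  have hstart : ∀ v (π : L v), ∀ α ∈ amosWithPrefix (within G H.verts) (T.ι v) π.1,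
      T.IsStart α v := by
    rintro v ⟨π, hπ, hFP⟩ α ⟨hα, hini, hpw⟩
    refine ⟨hini, fun S hS hSini => ?_⟩
    obtain ⟨p, hp, rfl⟩ := exists_prefix_of_isInitial hα (hΓ v) (T.mem_FP_iff.1 hS).1 hSini hπ hpw
    exact hFP p hp hS
  have hF : Function.Bijective F := by
    constructor
    · rintro ⟨v, π, α, hα⟩ ⟨w, σ, β, hβ⟩ h
      obtain rfl : α = β := congrArg Subtype.val h
      obtain rfl := T.isStart_unique hH hα.1 (hstart v π α hα) (hstart w σ α hβ)
      obtain rfl : π = σ :=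
        Subtype.ext (topological_list_unique hα.1 (hΓ v) π.2.1 σ.2.1 hα.2.2 hβ.2.2)
      rfl
    · rintro ⟨α, hα⟩
      obtain ⟨v, hv, hFP⟩ := T.exists_isStart hH hne hα
      obtain ⟨π, hπ, hpw⟩ := exists_topological_list (IsAMO.acyclic hα) (T.ι v)
      refine ⟨⟨v, ⟨π, hπ, fun p hp hS => ?_⟩, α, hα, hv, hpw⟩, rfl⟩
      exact hFP _ hS (isInitial_of_isPrefix hv hπ hpw hp)
  rw [numAMO, spanningCoe_eq_within hH, ← Nat.card_coe_set_eq,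
    ← Nat.card_congr (Equiv.ofBijective F hF), Nat.card_sigma]
  refine Finset.sum_congr rfl fun v _ => ?_
  have := Fintype.ofFinite (L v)
  obtain ⟨comps, hcomps⟩ := exists_enumerates (components H (T.ι v))
  rw [Nat.card_sigma, Finset.sum_congr rfl fun π _ => (Nat.card_coe_set_eq _).trans
    ((ncard_amosWithPrefix hG hH (hmax v).prop.1 (hmax v).prop.2 π.2.1 hcomps).trans
    (componentProduct_eq hcomps))]
  rw [Finset.sum_const, Finset.card_univ, ← Nat.card_eq_fintype_card, Nat.card_coe_set_eq,
    smul_eq_mul]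
  rfl

theorem components_prop {V : Type*} [Finite V] {G : SimpleGraph V} (hG : IsChordal G)
    {H : G.Subgraph} (hH : H.IsInduced) {K : Set V} (hKH : K ⊆ H.verts) (hK : K.Pairwise G.Adj)
    (hne : K.Nonempty) {C : G.Subgraph} (hC : C ∈ components H K) :
    C.IsInduced ∧ C.Connected ∧ C.verts.ncard < H.verts.ncard := by
  rw [components_eq hG hH hKH hK] at hC
  obtain ⟨v, hv, rfl⟩ := hC
  refine ⟨freeComponent_isInduced _ _ _, freeComponent_connected, ?_⟩
  have hsub : (freeComponent H K v).verts ⊆ H.verts \ K := fun z hz => reachable_freeGraph_mem hv hz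
  refine Set.ncard_lt_ncard ((Set.ssubset_iff_of_subset fun z hz => (hsub hz).1).2 ?_)
    (Set.toFinite _)
  obtain ⟨k, hk⟩ := hne
  exact ⟨k, hKH hk, fun h => (hsub h).2 hk⟩

/-! ### Subtrees of a rooted tree -/

/-- The nodes below `v` in the tree with root `r`. -/
def descendants {N : Type*} (t : SimpleGraph N) (r v : N) : Set N :=
  {w | t.dist r w = t.dist r v + t.dist v w}

theorem descendants_root {N : Type*} (t : SimpleGraph N) (r : N) :
    descendants t r r = Set.univ := by
  ext w
  simp [descendants]

theorem mem_descendants_iff {N : Type*} {t : SimpleGraph N} (ht : t.IsTree) {r v w : N} :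
    w ∈ descendants t r v ↔
      w = v ∨ ∃ c, (t.Adj v c ∧ t.dist r c = t.dist r v + 1) ∧ w ∈ descendants t r c := by
  have hconn := ht.connected
  constructor
  · intro h
    by_cases hwv : w = v
    · exact Or.inl hwv
    obtain ⟨p, hp⟩ := hconn.exists_walk_length_eq_dist v w
    cases p with
    | nil => exact absurd rfl hwv
    | @cons _ c _ hvc p =>
      rw [SimpleGraph.Walk.length_cons] at hp
      have h1 := SimpleGraph.dist_le p
      have h2 : t.dist r c ≤ t.dist r v + t.dist v c := hconn.dist_triangle
      have h3 : t.dist r w ≤ t.dist r c + t.dist c w := hconn.dist_triangle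
      have h4 : t.dist v c = 1 := SimpleGraph.dist_eq_one_iff_adj.2 hvc
      have h5 : t.dist r w = t.dist r v + t.dist v w := h
      refine Or.inr ⟨c, ⟨hvc, by omega⟩, ?_⟩
      change t.dist r w = t.dist r c + t.dist c w
      omega
  · rintro (rfl | ⟨c, ⟨hvc, hc⟩, h⟩)
    · simp [descendants]
    · have h1 : t.dist r w = t.dist r c + t.dist c w := h
      have h2 : t.dist v w ≤ t.dist v c + t.dist c w := hconn.dist_triangle
      have h3 : t.dist r w ≤ t.dist r v + t.dist v w := hconn.dist_triangle
      have h4 : t.dist v c = 1 := SimpleGraph.dist_eq_one_iff_adj.2 hvc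
      change t.dist r w = t.dist r v + t.dist v w
      omega

/-- A geodesic from `v` down to `w` may begin with either child, and paths in a tree are unique. -/
theorem descendants_disjoint {N : Type*} {t : SimpleGraph N} (ht : t.IsTree) {r v c c' w : N}
    (hvc : t.Adj v c) (hc : t.dist r c = t.dist r v + 1) (hvc' : t.Adj v c')
    (hc' : t.dist r c' = t.dist r v + 1) (hw : w ∈ descendants t r c)
    (hw' : w ∈ descendants t r c') : c = c' := by
  have hconn := ht.connected
  have key : ∀ c, t.Adj v c → t.dist r c = t.dist r v + 1 → w ∈ descendants t r c →
      ∃ p : t.Walk v w, p.IsPath ∧ p.snd = c := by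
    intro c hvc hc hw
    obtain ⟨p, hp⟩ := hconn.exists_walk_length_eq_dist c w
    have h1 : t.dist r w = t.dist r c + t.dist c w := hw
    have h3 : t.dist r w ≤ t.dist r v + t.dist v w := hconn.dist_triangle
    have h4 := SimpleGraph.dist_le (SimpleGraph.Walk.cons hvc p)
    refine ⟨.cons hvc p, SimpleGraph.Walk.isPath_of_length_eq_dist _ ?_, by simp⟩
    rw [SimpleGraph.Walk.length_cons] at h4 ⊢
    omega
  obtain ⟨p, hp, hpc⟩ := key c hvc hc hw
  obtain ⟨p', hp', hpc'⟩ := key c' hvc' hc' hw'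
  rw [← hpc, ← hpc', (ht.existsUnique_path v w).unique hp hp']

open Classical in
/-- The sum of `f` over the nodes below `v`. -/
noncomputable def subtreeSum {N : Type*} [Fintype N] (t : SimpleGraph N) (r : N) (f : N → ℕ)
    (v : N) : ℕ :=
  ∑ w with w ∈ descendants t r v, f w

theorem subtreeSum_root {N : Type*} [Fintype N] (t : SimpleGraph N) (r : N) (f : N → ℕ) :
    subtreeSum t r f r = ∑ w, f w := by
  simp [subtreeSum, descendants_root]

theorem subtreeSum_eq {N : Type*} [Fintype N] {t : SimpleGraph N} (ht : t.IsTree) {r : N}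
    (f : N → ℕ) {v : N} {children : List N}
    (hch : Enumerates children {c | t.Adj v c ∧ t.dist r c = t.dist r v + 1}) :
    subtreeSum t r f v = f v + (children.map (subtreeSum t r f)).sum := by
  classical
  have hset : (Finset.univ.filter fun w => w ∈ descendants t r v) =
      insert v (children.toFinset.biUnion fun c =>
        Finset.univ.filter fun w => w ∈ descendants t r c) := by
    ext w
    simp only [Finset.mem_filter, Finset.mem_univ, true_and, Finset.mem_insert, Finset.mem_biUnion,
      List.mem_toFinset]
    rw [mem_descendants_iff ht]
    refine or_congr_right (exists_congr fun c => and_congr_left fun _ => ?_)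
    exact (hch.2 c).symm
  have hv : v ∉ children.toFinset.biUnion fun c =>
      Finset.univ.filter fun w => w ∈ descendants t r c := by
    simp only [Finset.mem_biUnion, List.mem_toFinset, Finset.mem_filter, Finset.mem_univ, true_and]
    rintro ⟨c, hc, h⟩
    have h1 : t.dist r v = t.dist r c + t.dist c v := h
    have h2 := ((hch.2 c).1 hc).2
    omega
  rw [subtreeSum, hset, Finset.sum_insert hv, Finset.sum_biUnion, ← List.sum_toFinset _ hch.1]
  · rfl
  · intro c hc c' hc' hne
    have hc₁ := (hch.2 c).1 (List.mem_toFinset.1 hc)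
    have hc₂ := (hch.2 c').1 (List.mem_toFinset.1 hc')
    refine Finset.disjoint_left.2 fun w hw hw' => hne ?_
    exact descendants_disjoint ht hc₁.1 hc₁.2 hc₂.1 hc₂.2 (Finset.mem_filter.1 hw).2
      (Finset.mem_filter.1 hw').2

/-! ### Correctness of the algorithm -/

/-- Every run from the state ends, and it ends by returning `n` from the outermost call. -/
inductive Succeeds {V : Type*} {G : SimpleGraph V} (n : ℕ) : State G → Prop
  | done (memo : Memo G) : Succeeds n (.ret n [] memo)
  | step {s : State G} : (∃ s', Step s s') → (∀ s', Step s s' → Succeeds n s') → Succeeds n s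

theorem Succeeds.not_infinite {V : Type*} {G : SimpleGraph V} {n : ℕ} {s : State G}
    (h : Succeeds n s) : ¬ ∃ run : ℕ → State G, run 0 = s ∧ ∀ i, Step (run i) (run (i + 1)) := by
  induction h with
  | done memo =>
    rintro ⟨run, h0, h⟩
    have := h 0
    rw [h0] at this
    cases this
  | step _ _ ih =>
    rintro ⟨run, rfl, h⟩
    exact ih (run 1) (h 0) ⟨fun i => run (i + 1), rfl, fun i => h (i + 1)⟩

theorem Succeeds.eq_ret {V : Type*} {G : SimpleGraph V} {n : ℕ} {s t : State G}
    (h : Succeeds n s) (hst : Relation.ReflTransGen Step s t) (ht : ∀ s', ¬ Step t s') :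
    ∃ memo, t = .ret n [] memo := by
  induction h with
  | done memo =>
    rcases Relation.ReflTransGen.cases_head hst with rfl | ⟨s', hs', -⟩
    · exact ⟨memo, rfl⟩
    · cases hs'
  | step hex _ ih =>
    rcases Relation.ReflTransGen.cases_head hst with rfl | ⟨s', hs', hst'⟩
    · obtain ⟨s', hs'⟩ := hex
      exact absurd hs' (ht s')
    · exact ih s' hs' hst'

/-- All stored results are correct. -/
def Memo.Correct {V : Type*} {G : SimpleGraph V} (memo : Memo G) : Prop :=
  ∀ C k, memo C = some k → k = numAMO C.spanningCoe

/-- A call of `count H` succeeds if its continuation succeeds. -/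
def CallSucceeds {V : Type*} {G : SimpleGraph V} (n : ℕ) (H : G.Subgraph) : Prop :=
  ∀ (stack : List (LoopFrame G)) (memo : Memo G), memo.Correct →
    (∀ memo' : Memo G, memo'.Correct → Succeeds n (.ret (numAMO H.spanningCoe) stack memo')) →
    Succeeds n (.call H stack memo)

/-- The invariant is that `prod` times the counts of the remaining components is constant. Recursive
calls may alter the table, so only its correctness is carried along. -/
theorem succeeds_forLoop {V : Type*} {G : SimpleGraph V} {n : ℕ} {H : G.Subgraph}
    {T : RootedCliqueTree H} {sum : ℕ} {Q : List T.Node} {v : T.Node}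
    {stack : List (LoopFrame G)} (todo : List G.Subgraph) (prod : ℕ) (memo : Memo G)
    (hmemo : memo.Correct) (hcall : ∀ C ∈ todo, CallSucceeds n C)
    (hprod : prod * (todo.map fun C => numAMO C.spanningCoe).prod = componentProduct H (T.ι v))
    (hcont : ∀ memo' : Memo G, memo'.Correct → Succeeds n (.whileLoop
      ⟨H, T, sum + phi (T.ι v) (T.FP v) * componentProduct H (T.ι v), Q⟩ stack memo')) :
    Succeeds n (.forLoop ⟨⟨H, T, sum, Q⟩, v, prod, todo⟩ stack memo) := by
  induction todo generalizing prod memo with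
  | nil =>
    refine .step ⟨_, .add⟩ fun s' hs' => ?_
    cases hs'
    rw [List.map_nil, List.prod_nil, mul_one] at hprod
    rw [hprod]
    exact hcont memo hmemo
  | cons C todo ih =>
    refine .step ⟨_, .recurse⟩ fun s' hs' => ?_
    cases hs'
    refine hcall C (by simp) _ memo hmemo fun memo' hmemo' => ?_
    refine .step ⟨_, .resume⟩ fun s' hs' => ?_
    cases hs'
    refine ih _ memo' hmemo' (fun C' hC' => hcall C' (List.mem_cons_of_mem _ hC')) ?_
    rw [← hprod, List.map_cons, List.prod_cons, mul_assoc]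

/-- The invariant is that `sum` plus the contributions of the subtrees below the queued nodes is the
number of AMOs. The loop ends because the total size of these subtrees drops by one with each `pop`.
-/
theorem succeeds_whileLoop {V : Type*} [Finite V] {G : SimpleGraph V} {n : ℕ} {H : G.Subgraph}
    (T : RootedCliqueTree H) [Fintype T.Node] {stack : List (LoopFrame G)}
    (hcall : ∀ v, ∀ C ∈ components H (T.ι v), CallSucceeds n C)
    (hcont : ∀ memo : Memo G, memo.Correct →
      Succeeds n (.ret (numAMO H.spanningCoe) stack memo))
    (Q : List T.Node) (sum : ℕ) (memo : Memo G) (hmemo : memo.Correct)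
    (hsum : sum + (Q.map (subtreeSum T.tree T.root fun v =>
      phi (T.ι v) (T.FP v) * componentProduct H (T.ι v))).sum = numAMO H.spanningCoe) :
    Succeeds n (.whileLoop ⟨H, T, sum, Q⟩ stack memo) := by
  classical
  induction hm : (Q.map (subtreeSum T.tree T.root fun _ => 1)).sum using Nat.strong_induction_on
    generalizing Q sum memo with
  | _ m ih =>
  cases Q with
  | nil =>
    refine .step ⟨_, .finish⟩ fun s' hs' => ?_
    cases hs'
    rw [List.map_nil, List.sum_nil, add_zero] at hsum
    subst hsum
    refine hcont _ fun C k hC => ?_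
    by_cases h : C = H
    · subst h
      simpa using hC.symm
    · rw [Function.update_of_ne h] at hC
      exact hmemo C k hC
  | cons v Q =>
    obtain ⟨children, hchildren⟩ := exists_enumerates {w | T.IsChild v w}
    obtain ⟨comps, hcomps⟩ := exists_enumerates (components H (T.ι v))
    refine .step ⟨_, .pop hchildren hcomps⟩ fun s' hs' => ?_
    cases hs' with
    | @pop _ _ _ _ _ _ _ children hchildren comps hcomps =>
    refine succeeds_forLoop comps 1 memo hmemo (fun C hC => hcall v C ((hcomps.2 C).1 hC))
      (by rw [one_mul, componentProduct_eq hcomps]) fun memo' hmemo' => ?_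
    have hsub := fun f => subtreeSum_eq T.isTree (r := T.root) f hchildren
    refine ih _ ?_ _ _ memo' hmemo' ?_ rfl
    · rw [← hm, List.map_cons, List.sum_cons, hsub, List.map_append, List.sum_append]
      omega
    · rw [← hsum, List.map_cons, List.sum_cons, hsub, List.map_append, List.sum_append]
      ring

theorem callSucceeds {V : Type*} [Finite V] {G : SimpleGraph V} (hG : IsChordal G) (n : ℕ)
    (H : G.Subgraph) (hH : H.IsInduced) (hconn : H.Connected) : CallSucceeds n H := by
  classical
  induction hm : H.verts.ncard using Nat.strong_induction_on generalizing H with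
  | _ m ih =>
  intro stack memo hmemo hcont
  rcases hmH : memo H with _ | k
  · obtain ⟨T⟩ := hG.nonempty_rootedCliqueTree hH hconn
    refine .step ⟨_, .start hmH T⟩ fun s' hs' => ?_
    cases hs' with
    | lookup h => simp [hmH] at h
    | start h T =>
    have := Fintype.ofFinite T.Node
    refine succeeds_whileLoop T (fun v C hC => ?_) hcont [T.root] 0 memo hmemo ?_
    · have hmax := T.isMaxCliqueWithin hH v
      -- Since `H` has a vertex, the empty clique is not maximal; this makes every component
      -- strictly smaller than `H`.
      have hne : (T.ι v).Nonempty := by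
        by_contra hemp
        rw [Set.not_nonempty_iff_eq_empty] at hemp
        obtain ⟨x, hx⟩ := hconn.nonempty
        rw [hemp] at hmax
        exact hmax.le_of_ge (y := {x}) ⟨by simpa using hx, by simp⟩ (Set.empty_subset _) rfl
      obtain ⟨h1, h2, h3⟩ := components_prop hG hH hmax.prop.1 hmax.prop.2 hne hC
      exact ih _ (hm ▸ h3) C h1 h2 rfl
    · rw [List.map_singleton, List.sum_singleton, subtreeSum_root, zero_add,
        numAMO_eq_sum hG hH hconn.nonempty T]
  · refine .step ⟨_, .lookup hmH⟩ fun s' hs' => ?_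
    cases hs' with
    | @lookup _ _ _ k' h =>
      rw [hmemo H k' h]
      exact hcont memo hmemo
    | start h T => simp [hmH] at h

end CliquePicking

theorem mainTheorem2 {V : Type*} [Finite V] (G : SimpleGraph V) (hconn : G.Connected)
    (hchordal : CliquePicking.IsChordal G) :
    CliquePicking.Returns G (CliquePicking.numAMO G) := by
  have htop : (⊤ : G.Subgraph).Connected := by
    have := (SimpleGraph.Subgraph.topIso (G := G)).connected_iff.2 hconn
    exact ⟨this⟩
  have h : CliquePicking.Succeeds (CliquePicking.numAMO G)
      (CliquePicking.State.call (⊤ : G.Subgraph) [] fun _ => none) := by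
    refine CliquePicking.callSucceeds hchordal _ ⊤ (fun _ _ _ _ h => h) htop [] _
      (fun C k h => by simp at h) fun memo _ => ?_
    rw [SimpleGraph.Subgraph.spanningCoe_top]
    exact .done memo
  exact ⟨h.not_infinite, fun s hs hstuck => h.eq_ret hs hstuck⟩
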